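/- Let $\zeta'(-r)$ denote the derivative of the Riemann zeta function at $-r$ and $\gamma$ the Euler constant. Let $(G_n)_{n\ge 0}$ be the Vignéras multiple gamma functions, i.e. the unique hierarchy of meromorphic functions on $\mathbb{C}$ such that $G_0(z)=z$ and, for $n\ge 1$, (1) $G_n(z+1)=G_{n-1}(z)\,G_n(z)$, (2) $G_n(1)=1$, (3) $G_n(x+1)>0$ and $\frac{d^{n+1}}{dx^{n+1}}\log G_n(x+1)\ge 0$ for real $x\ge 0$. Then the following infinite products converge unconditionally and the following identities hold, the first and the third for all $z\in\mathbb{C}\setminus\{-1,-2,-3,\dots\}$, the second for all $z\in\mathbb{C}$ (where a product with a vanishing factor has the value $0$): $$G_3(z+1)=\exp\Big\{-\tfrac{z^3}{4}+\tfrac{z^2}{8}+\tfrac{7}{24}z+z\,\zeta'(-1)-\tfrac{z(z-1)}{2}\zeta'(0)-\Big(\tfrac{z^3}{6}-\tfrac{z^2}{4}\Big)\gamma\Big\}$$ $$\qquad\times\prod_{k=1}^\infty\Big[\Big(1+\tfrac zk\Big)^{-\frac{k(k+1)}{2}}\exp\Big\{\Big(\tfrac{z^3}{6}-\tfrac{z^2}{4}\Big)\tfrac1k-\Big(\tfrac{z^2}{4}-\tfrac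 z2\Big)+\tfrac z2k\Big\}\Big],$$ $$G_4(z+1)=\exp\Big\{-\tfrac{11}{144}z^4+\tfrac29z^3-\tfrac{5}{144}z^2-\tfrac{5}{24}z-\tfrac z2\zeta'(-2)+\tfrac{z^2-2z}{2}\zeta'(-1)-\tfrac{z^3-3z^2+2z}{6}\zeta'(0)-\tfrac{z^4-4z^3+4z^2}{24}\gamma\Big\}$$ $$\qquad\times\prod_{k=1}^\infty\Big[\Big(1+\tfrac zk\Big)^{\frac{k(k+1)(k+2)}{6}}\exp\Big\{\Big(\tfrac{z^4}{24}-\tfrac{z^3}{6}+\tfrac{z^2}{6}\Big)\tfrac1k-\Big(\tfrac{z^3}{18}-\tfrac{z^2}{4}+\tfrac z3\Big)+\Big(\tfrac{z^2}{12}-\tfrac z2\Big)k-\tfrac z6k^2\Big\}\Big],$$ $$G_5(z+1)=\exp\Big\{-\tfrac{5}{288}z^5+\tfrac{7}{64}z^4-\tfrac{161}{864}z^3+\tfrac{469}{2880}z+\tfrac z6\zeta'(-3)-\tfrac{z^2-3z}{4}\zeta'(-2)+\tfrac{2z^3-9z^2+11z}{12}\zeta'(-1)$$ $$\qquad\qquad-\tfrac{z^4-6z^3+11z^2-6z}{24}\zeta'(0)-\tfrac{6z^5-45z^4+110z^3-90z^2}{720}\gamma\Big\}$$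 $$\qquad\times\prod_{k=1}^\infty\Big[\Big(1+\tfrac zk\Big)^{-\frac{k(k+1)(k+2)(k+3)}{24}}\exp\Big\{\Big(\tfrac{z^5}{120}-\tfrac{z^4}{16}+\tfrac{11}{72}z^3-\tfrac{z^2}{8}\Big)\tfrac1k-\Big(\tfrac{z^4}{96}-\tfrac{z^3}{12}+\tfrac{11}{48}z^2-\tfrac z4\Big)$$ $$\qquad\qquad+\Big(\tfrac{z^3}{72}-\tfrac{z^2}{8}+\tfrac{11}{24}z\Big)k-\Big(\tfrac{z^2}{48}-\tfrac z4\Big)k^2+\tfrac{z}{24}k^3\Big\}\Big].$$ -/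

import Mathlib

/-- `IsNextMultipleGamma n g f` says that `f` is the level `n + 1` function of the hierarchy of
multiple gamma functions, when `g` is its level `n` function:
`f` is meromorphic on `ℂ`, `f (z + 1) = g z * f z`, `f 1 = 1`, and
`d ^ (n + 2) / dx ^ (n + 2) log f (x + 1) ≥ 0` for real `x ≥ 0`
(in particular `f (x + 1)` is a positive real number there, so that the logarithm makes sense).

Meromorphic functions are taken in normal form: removable singularities are removed, and the value
at a pole is `0`. The functional equation is required off the possible
poles `0, -1, -2, …` of `g` and `f`. -/
structure IsNextMultipleGamma (n : ℕ) (g f : ℂ → ℂ) : Prop where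
  meromorphic : MeromorphicNFOn f Set.univ
  map_add_one : ∀ z : ℂ, (∀ m : ℕ, z ≠ -(m : ℂ)) → f (z + 1) = g z * f z
  map_one : f 1 = 1
  pos : ∀ x : ℝ, 0 ≤ x → (f ((x : ℂ) + 1)).im = 0 ∧ 0 < (f ((x : ℂ) + 1)).re
  iteratedDeriv_log_nonneg : ∀ x : ℝ, 0 ≤ x →
    0 ≤ iteratedDeriv (n + 2) (fun t : ℝ => Real.log (f ((t : ℂ) + 1)).re) x

/-- The Vignéras multiple gamma functions `G_n`: `G_0 (z) = z`, and `G_(n+1)` is the function which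
satisfies the (generalized Bohr-Mollerup) conditions `IsNextMultipleGamma` relative to `G_n`.
(`Classical.epsilon P` satisfies `P` as soon as something does, and nothing can be proved about it
otherwise; here exactly one function satisfies the conditions. `G_1` is the gamma function and
`G_2` is the Barnes `G`-function.) -/
noncomputable def multipleGamma : ℕ → ℂ → ℂ
  | 0 => fun z => z
  | n + 1 => Classical.epsilon fun f : ℂ → ℂ => IsNextMultipleGamma n (multipleGamma n) f

/-- The `k`-th factor of the Weierstrass product of `G_3 (z + 1)`. The division in the integer
exponent is exact (and likewise in the factors below). -/
noncomputable def weierstrassFactorThree (z : ℂ) (k : ℕ+) : ℂ :=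
  (1 + z / (k : ℂ)) ^ (-((k : ℤ) * ((k : ℤ) + 1) / 2)) *
    Complex.exp ((z ^ 3 / 6 - z ^ 2 / 4) * (1 / (k : ℂ)) - (z ^ 2 / 4 - z / 2) + z / 2 * (k : ℂ))

/-- The `k`-th factor of the Weierstrass product of `G_4 (z + 1)`. -/
noncomputable def weierstrassFactorFour (z : ℂ) (k : ℕ+) : ℂ :=
  (1 + z / (k : ℂ)) ^ ((k : ℤ) * ((k : ℤ) + 1) * ((k : ℤ) + 2) / 6) *
    Complex.exp ((z ^ 4 / 24 - z ^ 3 / 6 + z ^ 2 / 6) * (1 / (k : ℂ))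
      - (z ^ 3 / 18 - z ^ 2 / 4 + z / 3)
      + (z ^ 2 / 12 - z / 2) * (k : ℂ)
      - z / 6 * (k : ℂ) ^ 2)

/-- The `k`-th factor of the Weierstrass product of `G_5 (z + 1)`. -/
noncomputable def weierstrassFactorFive (z : ℂ) (k : ℕ+) : ℂ :=
  (1 + z / (k : ℂ)) ^ (-((k : ℤ) * ((k : ℤ) + 1) * ((k : ℤ) + 2) * ((k : ℤ) + 3) / 24)) *
    Complex.exp ((z ^ 5 / 120 - z ^ 4 / 16 + 11 / 72 * z ^ 3 - z ^ 2 / 8) * (1 / (k : ℂ))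
      - (z ^ 4 / 96 - z ^ 3 / 12 + 11 / 48 * z ^ 2 - z / 4)
      + (z ^ 3 / 72 - z ^ 2 / 8 + 11 / 24 * z) * (k : ℂ)
      - (z ^ 2 / 48 - z / 4) * (k : ℂ) ^ 2
      + z / 24 * (k : ℂ) ^ 3)

/-! Each `G_n` with `1 ≤ n ≤ 5` is identified with an explicit function `exp (P z) * Π(z) ^ (±1)`,
shifted by one. Here `Π` is a canonical product with a zero of order `(k+n-2).choose (n-1)` at `-k`,
and `P` is a real polynomial of degree at most `n` without constant term. The sign is `(-1) ^ n`.
The three identities are then a matter of rewriting factors and exponents.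

The identification rests on uniqueness and existence. Uniqueness is a Bohr-Mollerup argument. The
logarithms of two candidates differ by a `1`-periodic function. The convexity condition bounds the
oscillation of its derivative of order `n` over a period by `d^n/dx^n log G_(n-1)(x+1)`, which tends
to `0`. That derivative is therefore constant, and a smooth periodic function with such a derivative
is constant (`IsNextMultipleGamma.unique`).

For existence, convexity is automatic. After `n+1` derivatives the polynomial and the convergence
factors vanish, and what is left is a series of nonnegative terms `mult k * n! / (x+k)^(n+1)`
(`hasSum_iteratedDeriv_log_weierstrassGamma`). The same series tends to `0` as `x → ∞`, which
supplies the hypothesis for uniqueness at the next level.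

The functional equation holds up to a factor `exp c(z)`, found by shifting the index in partial
products (`prod_factor_add_one`). Evaluating `c(z)` requires the asymptotics of the harmonic
numbers, which bring in Euler's constant, and those of `∑ k^j log k` for `j ≤ 3`, whose constant
terms are governed by `ζ'(-j)`. The latter come from Euler-Maclaurin summation of `(s-1) ζ(s)`,
pushed far enough to converge for `re s > -4` and differentiated in `s`. The polynomials `P` are
chosen so that the exponential factors match. -/

section MultipleGamma

open Filter Topology

/-! ### Euler-Maclaurin summation -/

/-- Taylor's theorem with a uniform bound on the last derivative, for a chain of derivatives. -/
lemma norm_sub_taylor_sum_le {n : ℕ} {g : ℕ → ℝ → ℂ} {C : ℝ}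
    (hg : ∀ i < n, ∀ x ∈ Set.Icc (0 : ℝ) 1, HasDerivAt (g i) (g (i + 1) x) x)
    (hC : ∀ x ∈ Set.Icc (0 : ℝ) 1, ‖g n x‖ ≤ C) {x : ℝ} (hx : x ∈ Set.Icc (0 : ℝ) 1) :
    ‖g 0 x - ∑ i ∈ Finset.range n, (x : ℂ) ^ i / (i.factorial : ℂ) * g i 0‖ ≤ C := by
  induction n generalizing g x with
  | zero => simpa using hC x hx
  | succ n ih =>
    -- The derivative of the Taylor remainder is the remainder of the shifted chain. The mean value
    -- inequality on an interval of length at most `1` then preserves the bound `C`; no factorial is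
    -- gained, and none is needed.
    have ih' := fun y (hy : y ∈ Set.Icc (0 : ℝ) 1) =>
      ih (g := fun i => g (i + 1)) (fun i hi y hy => hg (i + 1) (by omega) y hy) hC hy
    set φ : ℝ → ℂ := fun x =>
      g 0 x - ∑ i ∈ Finset.range (n + 1), (x : ℂ) ^ i / (i.factorial : ℂ) * g i 0 with hφ
    have hder : ∀ y ∈ Set.Icc (0 : ℝ) 1, HasDerivAt φ
        (g 1 y - ∑ i ∈ Finset.range n, (y : ℂ) ^ i / (i.factorial : ℂ) * g (i + 1) 0) y := by
      intro y hy
      refine (hg 0 (by omega) y hy).sub ?_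
      have h1 : HasDerivAt (fun x : ℝ => ∑ i ∈ Finset.range (n + 1),
          (x : ℂ) ^ i / (i.factorial : ℂ) * g i 0)
          (∑ i ∈ Finset.range (n + 1), ((i : ℂ) * (y : ℂ) ^ (i - 1)) / (i.factorial : ℂ) * g i 0)
          y := by
        refine HasDerivAt.fun_sum fun i _ => ?_
        exact (((hasDerivAt_pow i (y : ℂ)).comp_ofReal).div_const _).mul_const _
      convert! h1 using 1
      rw [Finset.sum_range_succ']
      simp only [CharP.cast_eq_zero, zero_mul, zero_div, add_zero, Nat.add_sub_cancel]
      refine Finset.sum_congr rfl fun i _ => ?_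
      have : ((i + 1 : ℕ) : ℂ) ≠ 0 := by exact_mod_cast Nat.succ_ne_zero i
      rw [Nat.factorial_succ, Nat.cast_mul, mul_div_mul_left _ _ this]
    have h0 : φ 0 = 0 := by
      simp [hφ, Finset.sum_range_succ']
    have := (convex_Icc (0 : ℝ) 1).norm_image_sub_le_of_norm_hasDerivWithin_le
      (fun y hy => (hder y hy).hasDerivWithinAt) (fun y hy => ih' y hy)
      (Set.left_mem_Icc.2 zero_le_one) hx
    rw [h0, sub_zero, sub_zero, Real.norm_eq_abs, abs_of_nonneg hx.1] at this
    have hC0 : 0 ≤ C := (norm_nonneg _).trans (hC x hx)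
    exact this.trans (mul_le_of_le_one_right hC0 hx.2)

/-- One step of Euler-Maclaurin summation of order four. -/
lemma norm_eulerMaclaurin_step_le {g : ℕ → ℝ → ℂ} {C : ℝ}
    (hg : ∀ i < 7, ∀ x ∈ Set.Icc (0 : ℝ) 1, HasDerivAt (g i) (g (i + 1) x) x)
    (hC : ∀ x ∈ Set.Icc (0 : ℝ) 1, ‖g 7 x‖ ≤ C) :
    ‖g 1 1 - (g 0 1 + g 1 1 / 2 + g 2 1 / 12 - g 4 1 / 720)
      + (g 0 0 + g 1 0 / 2 + g 2 0 / 12 - g 4 0 / 720)‖ ≤ 2 * C := by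
  have h1 : (1 : ℝ) ∈ Set.Icc (0 : ℝ) 1 := Set.right_mem_Icc.2 zero_le_one
  have T0 := norm_sub_taylor_sum_le hg hC h1
  have T1 := norm_sub_taylor_sum_le (n := 6) (g := fun i => g (i + 1))
    (fun i hi => hg (i + 1) (by omega)) hC h1
  have T2 := norm_sub_taylor_sum_le (n := 5) (g := fun i => g (i + 2))
    (fun i hi => hg (i + 2) (by omega)) hC h1
  have T4 := norm_sub_taylor_sum_le (n := 3) (g := fun i => g (i + 4))
    (fun i hi => hg (i + 4) (by omega)) hC h1
  simp only [Finset.sum_range_succ, Finset.sum_range_zero, Nat.factorial] at T0 T1 T2 T4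
  norm_num at T0 T1 T2 T4
  have hC0 : 0 ≤ C := (norm_nonneg _).trans T0
  set t0 := g 0 1 - _
  set t1 := g 1 1 - (g 1 0 + _ + _ + _ + _ + _)
  set t2 := g 2 1 - _
  set t4 := g 4 1 - _
  -- The Bernoulli weights make all Taylor coefficients at `0` cancel, leaving only remainders; `1 +
  -- 1/2 + 1/12 + 1/720 ≤ 2` gives the constant.
  have : g 1 1 - (g 0 1 + g 1 1 / 2 + g 2 1 / 12 - g 4 1 / 720)
      + (g 0 0 + g 1 0 / 2 + g 2 0 / 12 - g 4 0 / 720)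
      = -t0 + (1 / 2 : ℝ) * t1 - (1 / 12 : ℝ) * t2 + (1 / 720 : ℝ) * t4 := by
    simp only [t0, t1, t2, t4]; push_cast; ring
  rw [this]
  refine (norm_add_le _ _).trans ?_
  refine (add_le_add ((norm_sub_le _ _).trans (add_le_add (norm_add_le _ _) le_rfl)) le_rfl).trans ?_
  rw [norm_neg, norm_mul, norm_mul, norm_mul, Complex.norm_real, Complex.norm_real,
    Complex.norm_real]
  norm_num
  linarith

/-! ### Continuation of the zeta function to `re s > -4` -/

/-- The `i`-th derivative of `x ↦ -x ^ (1 - s)`. -/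
noncomputable def cpowDeriv (s : ℂ) (i : ℕ) (x : ℝ) : ℂ :=
  -(∏ j ∈ Finset.range i, (1 - s - j)) * (x : ℂ) ^ (1 - s - i)

lemma hasDerivAt_cpowDeriv (s : ℂ) (i : ℕ) {x : ℝ} (hx : 0 < x) :
    HasDerivAt (cpowDeriv s i) (cpowDeriv s (i + 1) x) x := by
  have h := ((hasDerivAt_id (x : ℂ)).cpow_const (c := 1 - s - i)
    (Complex.ofReal_mem_slitPlane.2 hx)).comp_ofReal.const_mul
    (-(∏ j ∈ Finset.range i, (1 - s - j)))
  convert! h using 1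
  simp only [cpowDeriv, Finset.prod_range_succ, id]
  push_cast
  rw [show (1 - s - (i + 1) : ℂ) = 1 - s - i - 1 by ring]
  ring

/-- The correction terms of Euler-Maclaurin summation for `∑ (s - 1) * k ^ (-s)`. -/
noncomputable def zetaCorrection (s : ℂ) (x : ℝ) : ℂ :=
  cpowDeriv s 0 x + cpowDeriv s 1 x / 2 + cpowDeriv s 2 x / 12 - cpowDeriv s 4 x / 720

/-- The general term of a series for `(s - 1) * ζ(s)` which converges for `-4 < re s`. -/
noncomputable def zetaTerm (s : ℂ) (k : ℕ) : ℂ :=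
  cpowDeriv s 1 (k + 2) - zetaCorrection s (k + 2) + zetaCorrection s (k + 1)

/-- The Euler-Maclaurin error is controlled by the seventh derivative of `-x ^ (1 - s)`, of size `x
^ (-6 - re s)`. For `re s > -4` the exponent is below `-2`, so the series converges, uniformly for
bounded `s`. -/
lemma norm_zetaTerm_le {s : ℂ} {R : ℝ} (hs : -4 < s.re) (hR : ‖s‖ ≤ R) (k : ℕ) :
    ‖zetaTerm s k‖ ≤ 2 * ((R + 7) ^ 7 * (1 / ((k : ℝ) + 1) ^ 2)) := by
  have key := norm_eulerMaclaurin_step_le (g := fun i h => cpowDeriv s i (h + ((k : ℝ) + 1)))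
    (C := (R + 7) ^ 7 * (1 / ((k : ℝ) + 1) ^ 2)) ?_ ?_
  · have e : (1 : ℝ) + ((k : ℝ) + 1) = k + 2 := by ring
    simp only [e, zero_add] at key
    exact key
  · intro i _ x hx
    exact (hasDerivAt_cpowDeriv s i (by have := hx.1; positivity)).comp_add_const x _
  · intro x hx
    have hx0 := hx.1
    have hpos : (0 : ℝ) < x + (k + 1) := by positivity
    have h1 : (1 : ℝ) ≤ x + (k + 1) := by linarith [(Nat.cast_nonneg k : (0 : ℝ) ≤ k)]
    simp only [cpowDeriv, norm_mul, norm_neg, norm_prod]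
    rw [Complex.norm_cpow_eq_rpow_re_of_pos hpos]
    have hR0 : 0 ≤ R := (norm_nonneg _).trans hR
    gcongr
    · calc ∏ j ∈ Finset.range 7, ‖1 - s - (j : ℂ)‖ ≤ ∏ j ∈ Finset.range 7, (R + 7) := by
            refine Finset.prod_le_prod (fun _ _ => norm_nonneg _) fun j hj => ?_
            have hj' : (j : ℝ) ≤ 6 := by
              have := Finset.mem_range.1 hj
              exact_mod_cast (by omega : j ≤ 6)
            calc ‖1 - s - (j : ℂ)‖ ≤ ‖(1 : ℂ)‖ + ‖s‖ + ‖(j : ℂ)‖ :=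
                  (norm_sub_le _ _).trans (add_le_add (norm_sub_le _ _) le_rfl)
              _ ≤ R + 7 := by simp; linarith
        _ = (R + 7) ^ 7 := by simp
    · calc (x + (k + 1)) ^ ((1 - s - (7 : ℕ)).re) ≤ (x + (k + 1)) ^ (-2 : ℝ) := by
            apply Real.rpow_le_rpow_of_exponent_le h1
            simp; linarith
        _ = 1 / (x + (k + 1)) ^ 2 := by
            rw [Real.rpow_neg hpos.le, one_div]; norm_num
        _ ≤ 1 / ((k : ℝ) + 1) ^ 2 := by
            exact one_div_le_one_div_of_le (by positivity)
              (pow_le_pow_left₀ (by positivity) (by linarith) 2)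

/-- The corrections telescope. The leading `s - 1` is the term `k = 1` of the Dirichlet sum. -/
lemma sum_zetaTerm (s : ℂ) (N : ℕ) :
    (s - 1) - zetaCorrection s 1 + ∑ k ∈ Finset.range N, zetaTerm s k
      = (s - 1) * ∑ k ∈ Finset.range (N + 1), ((k + 1 : ℕ) : ℂ) ^ (-s)
        - zetaCorrection s (N + 1) := by
  induction N with
  | zero => simp
  | succ N ih =>
    rw [Finset.sum_range_succ, ← add_assoc, ih, Finset.sum_range_succ _ (N + 1)]
    have : cpowDeriv s 1 (N + 2) = (s - 1) * ((N + 1 + 1 : ℕ) : ℂ) ^ (-s) := by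
      simp only [cpowDeriv, Finset.prod_range_one]
      push_cast
      rw [show (1 - s - 1 : ℂ) = -s by ring, show (N + 2 : ℂ) = N + 1 + 1 by ring]
      ring
    rw [zetaTerm, this]
    push_cast
    rw [show (N : ℝ) + 1 + 1 = N + 2 by ring]
    ring

lemma differentiable_cpowDeriv (i : ℕ) {x : ℝ} (hx : 0 < x) :
    Differentiable ℂ fun s => cpowDeriv s i x := by
  have hx' : (x : ℂ) ≠ 0 := by exact_mod_cast hx.ne'
  unfold cpowDeriv
  refine Differentiable.mul (by fun_prop) ?_
  intro s
  exact DifferentiableAt.const_cpow (by fun_prop) (Or.inl hx')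

lemma differentiable_zetaCorrection {x : ℝ} (hx : 0 < x) :
    Differentiable ℂ fun s => zetaCorrection s x := by
  have h := fun i => differentiable_cpowDeriv i hx
  unfold zetaCorrection
  exact (((h 0).add ((h 1).div_const _)).add ((h 2).div_const _)).sub ((h 4).div_const _)

lemma differentiable_zetaTerm (k : ℕ) : Differentiable ℂ fun s => zetaTerm s k := by
  unfold zetaTerm
  exact ((differentiable_cpowDeriv 1 (by positivity)).sub
    (differentiable_zetaCorrection (by positivity))).add
    (differentiable_zetaCorrection (by positivity))

lemma summable_zetaTerm_bound (R : ℝ) :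
    Summable fun k : ℕ => 2 * ((R + 7) ^ 7 * (1 / ((k : ℝ) + 1) ^ 2)) := by
  have := (summable_nat_add_iff 1).2 (Real.summable_one_div_nat_pow.2 (one_lt_two))
  push_cast at this
  exact (this.mul_left _).mul_left _

lemma tendsto_zetaCorrection {s : ℂ} (hs : 1 < s.re) :
    Filter.Tendsto (fun N : ℕ => zetaCorrection s ((N : ℝ) + 1)) Filter.atTop (nhds 0) := by
  have h : ∀ i : ℕ, Filter.Tendsto (fun N : ℕ => cpowDeriv s i ((N : ℝ) + 1))
      Filter.atTop (nhds 0) := by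
    intro i
    rw [← mul_zero (-(∏ j ∈ Finset.range i, (1 - s - j)))]
    refine Filter.Tendsto.const_mul _ ?_
    rw [tendsto_zero_iff_norm_tendsto_zero]
    have e : ∀ N : ℕ, ‖(((N : ℝ) + 1 : ℝ) : ℂ) ^ (1 - s - i)‖
        = ((N : ℝ) + 1) ^ (-(s.re + i - 1)) := by
      intro N
      rw [Complex.norm_cpow_eq_rpow_re_of_pos (by positivity)]
      congr 1
      simp; ring
    simp only [e]
    refine (tendsto_rpow_neg_atTop ?_).comp
      (Filter.tendsto_atTop_add_const_right _ _ tendsto_natCast_atTop_atTop)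
    have : (0 : ℝ) ≤ i := Nat.cast_nonneg i
    linarith
  have := (((h 0).add ((h 1).div_const 2)).add ((h 2).div_const 12)).sub ((h 4).div_const 720)
  simpa [zetaCorrection] using this

lemma riemannZeta₁_eq_tsum_of_one_lt_re {s : ℂ} (hs : 1 < s.re) :
    riemannZeta₁ s = (s - 1) - zetaCorrection s 1 + ∑' k, zetaTerm s k := by
  have hs1 : s ≠ 1 := by rintro rfl; simp at hs
  have h1 : Filter.Tendsto (fun N : ℕ => (s - 1) - zetaCorrection s 1
      + ∑ k ∈ Finset.range N, zetaTerm s k) Filter.atTop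
      (nhds ((s - 1) - zetaCorrection s 1 + ∑' k, zetaTerm s k)) := by
    refine Filter.Tendsto.const_add _ (Summable.hasSum ?_).tendsto_sum_nat
    exact Summable.of_norm_bounded (summable_zetaTerm_bound ‖s‖)
      (norm_zetaTerm_le (by linarith) le_rfl)
  simp only [sum_zetaTerm] at h1
  have h2 : Filter.Tendsto (fun N : ℕ => (s - 1) * ∑ k ∈ Finset.range (N + 1),
      ((k + 1 : ℕ) : ℂ) ^ (-s) - zetaCorrection s (N + 1)) Filter.atTop
      (nhds ((s - 1) * riemannZeta s - 0)) := by
    refine Filter.Tendsto.sub (Filter.Tendsto.const_mul _ ?_) (tendsto_zetaCorrection hs)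
    rw [zeta_eq_tsum_one_div_nat_add_one_cpow hs]
    have hsum : Summable fun n : ℕ => 1 / ((n : ℂ) + 1) ^ s := by
      have := (summable_nat_add_iff 1).2 (Complex.summable_one_div_nat_cpow.2 hs)
      simpa using this
    have := hsum.hasSum.tendsto_sum_nat.comp (Filter.tendsto_add_atTop_nat 1)
    refine this.congr fun N => ?_
    simp [Complex.cpow_neg]
  rw [tendsto_nhds_unique h1 h2, sub_zero, riemannZeta_eq_inv_sub_mul hs1,
    mul_inv_cancel_left₀ (sub_ne_zero.2 hs1)]

lemma tendstoLocallyUniformlyOn_zetaTerm_sum (R : ℝ) :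
    TendstoLocallyUniformlyOn (fun (N : ℕ) (s : ℂ) => (s - 1) - zetaCorrection s 1
      + ∑ k ∈ Finset.range N, zetaTerm s k)
      (fun s => (s - 1) - zetaCorrection s 1 + ∑' k, zetaTerm s k) Filter.atTop
      ({s : ℂ | -4 < s.re} ∩ Metric.ball 0 R) := by
  apply TendstoUniformlyOn.tendstoLocallyUniformlyOn
  have h := tendstoUniformlyOn_tsum_nat (f := fun k s => zetaTerm s k)
    (s := {s : ℂ | -4 < s.re} ∩ Metric.ball 0 R) (summable_zetaTerm_bound R)
    (fun k s hs => norm_zetaTerm_le hs.1 (mem_ball_zero_iff.1 hs.2).le k)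
  rw [Metric.tendstoUniformlyOn_iff] at h ⊢
  simpa only [dist_add_left] using h

lemma isOpen_halfPlane_inter_ball (R : ℝ) :
    IsOpen ({s : ℂ | -4 < s.re} ∩ Metric.ball 0 R) :=
  (isOpen_lt continuous_const Complex.continuous_re).inter Metric.isOpen_ball

lemma differentiable_zetaTerm_sum (N : ℕ) :
    Differentiable ℂ fun s : ℂ => (s - 1) - zetaCorrection s 1
      + ∑ k ∈ Finset.range N, zetaTerm s k :=
  ((differentiable_id.sub_const _).sub (differentiable_zetaCorrection one_pos)).add
    (Differentiable.fun_sum fun k _ => differentiable_zetaTerm k)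

lemma riemannZeta₁_eqOn_tsum (R : ℝ) : Set.EqOn riemannZeta₁
    (fun s => (s - 1) - zetaCorrection s 1 + ∑' k, zetaTerm s k)
    ({s : ℂ | -4 < s.re} ∩ Metric.ball 0 R) := by
  -- The identity theorem needs a point of the domain with real part above `1`; the radius is
  -- enlarged so that `2` serves.
  wlog hR : 2 < R generalizing R
  · exact (this 3 (by norm_num)).mono
      (Set.inter_subset_inter_right _ (Metric.ball_subset_ball (by linarith)))
  have hopen := isOpen_halfPlane_inter_ball R
  have hd := (tendstoLocallyUniformlyOn_zetaTerm_sum R).differentiableOn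
    (.of_forall fun N => (differentiable_zetaTerm_sum N).differentiableOn) hopen
  have hpre : IsPreconnected ({s : ℂ | -4 < s.re} ∩ Metric.ball (0 : ℂ) R) :=
    ((convex_halfSpace_re_gt (-4)).inter (convex_ball 0 R)).isPreconnected
  refine (differentiable_riemannZeta₁.differentiableOn.analyticOnNhd hopen).eqOn_of_preconnected_of_eventuallyEq
    (hd.analyticOnNhd hopen) hpre (z₀ := 2) ⟨by norm_num, by simpa using hR⟩ ?_
  filter_upwards [(isOpen_lt continuous_const Complex.continuous_re).mem_nhds
    (show (1 : ℝ) < (2 : ℂ).re by norm_num)] with s hs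
  exact riemannZeta₁_eq_tsum_of_one_lt_re hs

/-- The derivative of `ζ` at a point with real part in `(-4, 1)` as a limit. -/
lemma tendsto_deriv_sum_sub_zetaCorrection {s : ℂ} (hs : -4 < s.re) (hs1 : s ≠ 1) :
    Filter.Tendsto (fun N : ℕ => deriv (fun s : ℂ => ∑ k ∈ Finset.range (N + 1),
      ((k + 1 : ℕ) : ℂ) ^ (-s) - (s - 1)⁻¹ * zetaCorrection s (N + 1)) s) Filter.atTop
      (nhds (deriv riemannZeta s)) := by
  set R : ℝ := ‖s‖ + 1
  have hopen := (isOpen_halfPlane_inter_ball R).inter (isOpen_compl_singleton (x := (1 : ℂ)))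
  set U := ({s : ℂ | -4 < s.re} ∩ Metric.ball 0 R) ∩ {(1 : ℂ)}ᶜ
  have hsU : s ∈ U := ⟨⟨hs, by simp [R]⟩, hs1⟩
  have h1 := ((tendstoLocallyUniformlyOn_zetaTerm_sum R).congr_right
    (riemannZeta₁_eqOn_tsum R).symm)
  have h2 : Filter.Tendsto _ _ _ := h1.tendsto_at hsU.1
  -- Locally uniform convergence of holomorphic functions passes to derivatives. Together with `h2`
  -- this recovers `ζ'` from `(s - 1) ζ(s)` by the product rule.
  have h3 : Filter.Tendsto _ _ _ := (h1.deriv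
    (.of_forall fun N => (differentiable_zetaTerm_sum N).differentiableOn)
    (isOpen_halfPlane_inter_ball R)).tendsto_at hsU.1
  rw [deriv_riemannZeta_eq_neg_inv_sub_sq_mul_add hs1]
  refine ((h2.const_mul _).add (h3.const_mul _)).congr fun N => ?_
  have hne : s - 1 ≠ 0 := sub_ne_zero.2 hs1
  have hev : (fun s : ℂ => ∑ k ∈ Finset.range (N + 1),
      ((k + 1 : ℕ) : ℂ) ^ (-s) - (s - 1)⁻¹ * zetaCorrection s (N + 1))
      =ᶠ[nhds s] fun s => (s - 1)⁻¹ * ((s - 1) - zetaCorrection s 1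
      + ∑ k ∈ Finset.range N, zetaTerm s k) := by
    filter_upwards [isOpen_compl_singleton.mem_nhds hs1] with w hw
    rw [sum_zetaTerm, mul_sub, inv_mul_cancel_left₀ (sub_ne_zero.2 hw)]
  have hinv : HasDerivAt (fun s : ℂ => (s - 1)⁻¹) (-((s - 1)⁻¹) ^ 2) s := by
    have := ((hasDerivAt_id s).sub_const 1).inv hne
    convert! this using 1
    simp [neg_div]
  rw [hev.deriv_eq]
  exact (hinv.mul ((differentiable_zetaTerm_sum N) s).hasDerivAt).deriv.symm

lemma hasDerivAt_cpow_neg_sub {x : ℝ} (hx : 0 < x) (c s : ℂ) :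
    HasDerivAt (fun s : ℂ => (x : ℂ) ^ (c - s)) (-((Real.log x : ℂ) * (x : ℂ) ^ (c - s))) s := by
  have hx' : (x : ℂ) ≠ 0 := by exact_mod_cast hx.ne'
  have := ((hasDerivAt_id s).const_sub c).const_cpow (c := (x : ℂ)) (Or.inl hx')
  convert! this using 1
  rw [Complex.ofReal_log hx.le]
  simp only [id]
  ring

lemma inv_mul_zetaCorrection {s : ℂ} (hs : s ≠ 1) {x : ℝ} :
    (s - 1)⁻¹ * zetaCorrection s x = (x : ℂ) ^ (1 - s) / (1 - s) + (x : ℂ) ^ (0 - s) / 2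
      - s * (x : ℂ) ^ (-1 - s) / 12 + s * (s + 1) * (s + 2) * (x : ℂ) ^ (-3 - s) / 720 := by
  have h1 : s - 1 ≠ 0 := sub_ne_zero.2 hs
  have h2 : 1 - s ≠ 0 := sub_ne_zero.2 hs.symm
  simp only [zetaCorrection, cpowDeriv, Finset.prod_range_succ, Finset.prod_range_zero]
  push_cast
  rw [show (1 - s - 0 : ℂ) = 1 - s by ring, show (1 - s - 1 : ℂ) = 0 - s by ring,
    show (1 - s - 2 : ℂ) = -1 - s by ring, show (1 - s - 4 : ℂ) = -3 - s by ring]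
  field_simp
  ring

/-! ### Asymptotics of `∑ k ^ j * log k` and the values `ζ'(-j)` -/

/-- The terms which compensate `∑ k ^ j * log k` in the limit formula for `ζ'(-j)`. -/
noncomputable def sumPowLogCorrection (j : ℕ) (x : ℝ) : ℝ :=
  -(Real.log x * x ^ (j + 1) / (j + 1)) + x ^ (j + 1) / (j + 1) ^ 2 - Real.log x * x ^ j / 2
    - (x ^ j / x) / 12 - j * (Real.log x * (x ^ j / x)) / 12
    + (3 * j ^ 2 - 6 * j + 2) * (x ^ j / x ^ 3) / 720
    + j * (j - 1) * (j - 2) * (Real.log x * (x ^ j / x ^ 3)) / 720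

lemma deriv_sum_sub_zetaCorrection (j N : ℕ) :
    deriv (fun s : ℂ => ∑ k ∈ Finset.range (N + 1),
      ((k + 1 : ℕ) : ℂ) ^ (-s) - (s - 1)⁻¹ * zetaCorrection s (N + 1)) (-j)
    = ((-(∑ k ∈ Finset.range (N + 1), ((k : ℝ) + 1) ^ j * Real.log (k + 1)
      + sumPowLogCorrection j (N + 1)) : ℝ) : ℂ) := by
  have hj : (-(j : ℂ)) ≠ 1 := by
    intro h
    have := congrArg Complex.re h
    simp at this
    linarith [(Nat.cast_nonneg j : (0 : ℝ) ≤ j)]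
  have hj1 : (1 : ℂ) + j ≠ 0 := by
    intro h
    apply hj
    linear_combination -h
  set x : ℝ := N + 1 with hx
  have hx0 : 0 < x := by positivity
  have hxc : (x : ℂ) ≠ 0 := by exact_mod_cast hx0.ne'
  have hev : (fun s : ℂ => ∑ k ∈ Finset.range (N + 1),
      ((k + 1 : ℕ) : ℂ) ^ (-s) - (s - 1)⁻¹ * zetaCorrection s x) =ᶠ[nhds (-(j : ℂ))]
      fun s => ∑ k ∈ Finset.range (N + 1), (((k + 1 : ℝ) : ℝ) : ℂ) ^ (0 - s)
      - ((x : ℂ) ^ (1 - s) / (1 - s) + (x : ℂ) ^ (0 - s) / 2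
      - s * (x : ℂ) ^ (-1 - s) / 12 + s * (s + 1) * (s + 2) * (x : ℂ) ^ (-3 - s) / 720) := by
    filter_upwards [isOpen_compl_singleton.mem_nhds hj] with w hw
    rw [inv_mul_zetaCorrection hw]
    push_cast
    simp only [zero_sub]
  rw [hev.deriv_eq]
  have hid := hasDerivAt_id (-(j : ℂ))
  have hcub : HasDerivAt (fun s : ℂ => s * (s + 1) * (s + 2)) _ (-(j : ℂ)) :=
    (hid.mul (hid.add_const 1)).mul (hid.add_const 2)
  have hsum : HasDerivAt (fun s : ℂ => ∑ k ∈ Finset.range (N + 1),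
      (((k + 1 : ℝ) : ℝ) : ℂ) ^ (0 - s)) _ (-(j : ℂ)) :=
    HasDerivAt.fun_sum fun k _ => hasDerivAt_cpow_neg_sub (x := (k : ℝ) + 1) (by positivity) 0 _
  have h1 := (hasDerivAt_cpow_neg_sub hx0 1 (-(j : ℂ))).div (hid.const_sub 1)
    (by simpa using hj1)
  have h2 := (hasDerivAt_cpow_neg_sub hx0 0 (-(j : ℂ))).div_const 2
  have h3 := (hid.mul (hasDerivAt_cpow_neg_sub hx0 (-1) (-(j : ℂ)))).div_const 12
  have h4 := (hcub.mul (hasDerivAt_cpow_neg_sub hx0 (-3) (-(j : ℂ)))).div_const 720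
  have := (hsum.sub (((h1.add h2).sub h3).add h4)).deriv
  refine Eq.trans this ?_
  have e0 : ∀ y : ℝ, (y : ℂ) ^ ((0 : ℂ) - -(j : ℂ)) = (y : ℂ) ^ j := fun y => by
    rw [show (0 : ℂ) - -(j : ℂ) = (j : ℕ) by ring, Complex.cpow_natCast]
  have e1 : (x : ℂ) ^ ((1 : ℂ) - -(j : ℂ)) = (x : ℂ) ^ (j + 1) := by
    rw [show (1 : ℂ) - -(j : ℂ) = (j + 1 : ℕ) by push_cast; ring, Complex.cpow_natCast]
  have e2 : (x : ℂ) ^ ((-1 : ℂ) - -(j : ℂ)) = (x : ℂ) ^ j / x := by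
    rw [show (-1 : ℂ) - -(j : ℂ) = (j : ℕ) - 1 by ring, Complex.cpow_sub _ _ hxc,
      Complex.cpow_natCast, Complex.cpow_one]
  have e3 : (x : ℂ) ^ ((-3 : ℂ) - -(j : ℂ)) = (x : ℂ) ^ j / (x : ℂ) ^ 3 := by
    rw [show (-3 : ℂ) - -(j : ℂ) = (j : ℕ) - (3 : ℕ) by push_cast; ring,
      Complex.cpow_sub _ _ hxc, Complex.cpow_natCast, Complex.cpow_natCast]
  simp only [e0, e1, e2, e3, id, Finset.sum_neg_distrib, Pi.mul_apply]
  have es : ∀ k : ℕ, (Real.log ((k : ℝ) + 1) : ℂ) * (((k : ℝ) + 1 : ℝ) : ℂ) ^ j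
      = (((k : ℝ) + 1 : ℝ) : ℂ) ^ j * (Real.log ((k : ℝ) + 1) : ℂ) := fun k => mul_comm _ _
  simp only [es, sumPowLogCorrection]
  generalize Real.log x = l
  have hj2 : (j : ℂ) + 1 ≠ 0 := by rwa [add_comm]
  clear_value x
  push_cast
  rw [show (1 : ℂ) - -(j : ℂ) = j + 1 by ring]
  generalize (∑ k ∈ Finset.range (N + 1), ((k : ℂ) + 1) ^ j * (Real.log ((k : ℝ) + 1) : ℂ)) = S
  field_simp
  ring

lemma tendsto_sum_pow_mul_log_aux {j : ℕ} (hj : j < 4) :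
    Filter.Tendsto (fun N : ℕ => ((-(∑ k ∈ Finset.range N, ((k : ℝ) + 1) ^ j * Real.log (k + 1)
      + sumPowLogCorrection j N) : ℝ) : ℂ)) Filter.atTop (nhds (deriv riemannZeta (-j))) := by
  have hj4 : (j : ℝ) < 4 := by exact_mod_cast hj
  have h := tendsto_deriv_sum_sub_zetaCorrection (s := -(j : ℂ)) (by simpa using hj4) (by
    intro h
    have := congrArg Complex.re h
    simp at this
    linarith [(Nat.cast_nonneg j : (0 : ℝ) ≤ j)])
  simp only [deriv_sum_sub_zetaCorrection] at h
  rw [← Filter.tendsto_add_atTop_iff_nat 1]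
  simpa using h

/-- `ζ'(-j)` is real for `j = 0, 1, 2, 3`. -/
lemma ofReal_re_deriv_riemannZeta_neg {j : ℕ} (hj : j < 4) :
    (((deriv riemannZeta (-j)).re : ℝ) : ℂ) = deriv riemannZeta (-j) := by
  have h := tendsto_sum_pow_mul_log_aux hj
  have h1 := (Complex.continuous_im.tendsto _).comp h
  have h2 := tendsto_nhds_unique h1 ((tendsto_const_nhds (x := (0 : ℝ))).congr fun N =>
    (Complex.ofReal_im _).symm)
  exact Complex.ext (by simp) (by simp [h2])

lemma tendsto_sum_pow_mul_log {j : ℕ} (hj : j < 4) :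
    Filter.Tendsto (fun N : ℕ => ∑ k ∈ Finset.range N, ((k : ℝ) + 1) ^ j * Real.log (k + 1)
      + sumPowLogCorrection j N) Filter.atTop (nhds (-(deriv riemannZeta (-j)).re)) := by
  have h := ((Complex.continuous_re.tendsto _).comp (tendsto_sum_pow_mul_log_aux hj)).neg
  simpa only [Function.comp_def, Complex.ofReal_re, neg_neg] using h

/-- Here and in the next three lemmas the negative powers of `N` in `sumPowLogCorrection` tend to
`0` and are discarded; the rest is the stated asymptotic expansion. -/
lemma tendsto_sum_log :
    Filter.Tendsto (fun N : ℕ => ∑ k ∈ Finset.range N, Real.log ((k : ℝ) + 1)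
      - (((N : ℝ) + 1 / 2) * Real.log N - N) + (deriv riemannZeta 0).re)
      Filter.atTop (nhds 0) := by
  have h := tendsto_sum_pow_mul_log (j := 0) (by norm_num)
  have h1 : Filter.Tendsto (fun N : ℕ => (N : ℝ)⁻¹) Filter.atTop (nhds 0) :=
    tendsto_inv_atTop_nhds_zero_nat
  have := ((h.add (h1.mul_const (1 / 12))).sub ((h1.pow 3).mul_const (2 / 720))).add_const
    (deriv riemannZeta 0).re
  refine (this.congr fun N => ?_).trans (by simp)
  simp [sumPowLogCorrection]
  ring

lemma tendsto_sum_mul_log :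
    Filter.Tendsto (fun N : ℕ => ∑ k ∈ Finset.range N, ((k : ℝ) + 1) * Real.log ((k : ℝ) + 1)
      - (((N : ℝ) ^ 2 / 2 + N / 2 + 1 / 12) * Real.log N - (N : ℝ) ^ 2 / 4 + 1 / 12)
      + (deriv riemannZeta (-1)).re) Filter.atTop (nhds 0) := by
  have h := tendsto_sum_pow_mul_log (j := 1) (by norm_num)
  have h1 : Filter.Tendsto (fun N : ℕ => (N : ℝ)⁻¹) Filter.atTop (nhds 0) :=
    tendsto_inv_atTop_nhds_zero_nat
  have := (h.add ((h1.pow 2).mul_const (1 / 720))).add_const (deriv riemannZeta (-1)).re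
  refine (this.congr' ?_).trans (by simp)
  filter_upwards [Filter.eventually_gt_atTop 0] with N hN
  have : (N : ℝ) ≠ 0 := by positivity
  simp [sumPowLogCorrection]
  field_simp
  ring

lemma tendsto_sum_sq_mul_log :
    Filter.Tendsto (fun N : ℕ => ∑ k ∈ Finset.range N, ((k : ℝ) + 1) ^ 2 * Real.log ((k : ℝ) + 1)
      - (((N : ℝ) ^ 3 / 3 + (N : ℝ) ^ 2 / 2 + N / 6) * Real.log N - (N : ℝ) ^ 3 / 9 + N / 12)
      + (deriv riemannZeta (-2)).re) Filter.atTop (nhds 0) := by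
  have h := tendsto_sum_pow_mul_log (j := 2) (by norm_num)
  have h1 : Filter.Tendsto (fun N : ℕ => (N : ℝ)⁻¹) Filter.atTop (nhds 0) :=
    tendsto_inv_atTop_nhds_zero_nat
  have := (h.sub (h1.mul_const (2 / 720))).add_const (deriv riemannZeta (-2)).re
  refine (this.congr' ?_).trans (by simp)
  filter_upwards [Filter.eventually_gt_atTop 0] with N hN
  have : (N : ℝ) ≠ 0 := by positivity
  simp [sumPowLogCorrection]
  field_simp
  ring

lemma tendsto_sum_cube_mul_log :
    Filter.Tendsto (fun N : ℕ => ∑ k ∈ Finset.range N, ((k : ℝ) + 1) ^ 3 * Real.log ((k : ℝ) + 1)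
      - (((N : ℝ) ^ 4 / 4 + (N : ℝ) ^ 3 / 2 + (N : ℝ) ^ 2 / 4 - 1 / 120) * Real.log N
        - (N : ℝ) ^ 4 / 16 + (N : ℝ) ^ 2 / 12 - 11 / 720)
      + (deriv riemannZeta (-3)).re) Filter.atTop (nhds 0) := by
  have h := tendsto_sum_pow_mul_log (j := 3) (by norm_num)
  have := h.add_const (deriv riemannZeta (-3)).re
  refine (this.congr' ?_).trans (by simp)
  filter_upwards [Filter.eventually_gt_atTop 0] with N hN
  have : (N : ℝ) ≠ 0 := by positivity
  simp [sumPowLogCorrection]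
  field_simp
  ring

/-! ### Uniqueness: the generalized Bohr-Mollerup theorem -/

lemma MeromorphicNFAt.analyticAt_of_ne_zero {f : ℂ → ℂ} {x : ℂ} (h : MeromorphicNFAt f x)
    (hx : f x ≠ 0) : AnalyticAt ℂ f x :=
  h.meromorphicOrderAt_nonneg_iff_analyticAt.1 (h.meromorphicOrderAt_eq_zero_iff.2 hx).ge

lemma analyticAt_log_re {f : ℂ → ℂ} {t : ℝ} (hf : AnalyticAt ℂ f ((t : ℂ) + 1))
    (hpos : 0 < (f ((t : ℂ) + 1)).re) :
    AnalyticAt ℝ (fun t : ℝ => Real.log (f ((t : ℂ) + 1)).re) t := by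
  have h1 : ContDiffAt ℂ ⊤ (fun z : ℂ => f (z + 1)) t :=
    (hf.comp_of_eq (g := f) (f := fun z : ℂ => z + 1) (by fun_prop) rfl).contDiffAt
  exact (h1.real_of_complex.log hpos.ne').analyticAt

lemma hasDerivAt_iteratedDeriv {f : ℝ → ℝ} {t : ℝ} (hf : AnalyticAt ℝ f t) (m : ℕ) :
    HasDerivAt (iteratedDeriv m f) (iteratedDeriv (m + 1) f t) t := by
  rw [iteratedDeriv_succ]
  refine DifferentiableAt.hasDerivAt ?_
  rw [iteratedDeriv_eq_iterate]
  exact (hf.iterated_deriv m).differentiableAt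

/-- A smooth function which is `1`-periodic on `[0, ∞)` and has a vanishing derivative of some
order is constant. -/
lemma eq_of_periodic_of_iteratedDeriv_eq_zero {d : ℝ → ℝ} (hd : ∀ t, 0 ≤ t → AnalyticAt ℝ d t)
    (hper : ∀ m : ℕ, ∀ t, 0 < t → iteratedDeriv m d (t + 1) = iteratedDeriv m d t) {m : ℕ}
    (hm : ∀ t, 0 < t → iteratedDeriv (m + 1) d t = 0) {t : ℝ} (ht : 0 ≤ t) : d t = d 0 := by
  have hder := fun m t (ht : 0 ≤ t) => hasDerivAt_iteratedDeriv (hd t ht) m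
  induction m with
  | zero =>
    rcases ht.eq_or_lt with rfl | ht
    · rfl
    obtain ⟨c, hc, h⟩ := exists_hasDerivAt_eq_slope (iteratedDeriv 0 d) (iteratedDeriv 1 d) ht
      (fun s hs => (hder 0 s hs.1).continuousAt.continuousWithinAt)
      (fun s hs => hder 0 s hs.1.le)
    rw [hm c hc.1, eq_comm, div_eq_zero_iff] at h
    rcases h with h | h
    · simpa [sub_eq_zero] using h
    · linarith
  | succ m ih =>
    refine ih fun t ht => ?_
    -- By periodicity and Rolle, the derivative of order `m + 1` vanishes at some `c` in `(t, t +
    -- 1)`. Since its own derivative is zero, it is constant between `t` and `c`, hence zero at `t`.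
    obtain ⟨c, hc, h⟩ := exists_hasDerivAt_eq_zero (f := iteratedDeriv m d)
      (f' := iteratedDeriv (m + 1) d) (lt_add_one t)
      (fun s hs => (hder m s (ht.le.trans hs.1)).continuousAt.continuousWithinAt)
      (hper m t ht).symm (fun s hs => hder m s (ht.le.trans hs.1.le))
    obtain ⟨ξ, hξ, h'⟩ := exists_hasDerivAt_eq_slope (iteratedDeriv (m + 1) d)
      (iteratedDeriv (m + 2) d) hc.1
      (fun s hs => (hder _ s (ht.le.trans hs.1)).continuousAt.continuousWithinAt)
      (fun s hs => hder _ s (ht.le.trans hs.1.le))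
    rw [hm ξ (ht.trans hξ.1), h, eq_comm, div_eq_zero_iff] at h'
    rcases h' with h' | h'
    · linarith
    · linarith [hc.1]

/-- The difference `d = u - v` is `1`-periodic. The derivatives of order `n + 1` of `u` and `v` are
monotone and both grow by `w^(n+1)(t)` over `[t, t + 1]`, so the derivative of `d` varies there by
at most that amount. Periodicity allows replacing `t` by `t + N`, where the bound tends to `0`. -/
lemma eq_of_add_one_of_iteratedDeriv_nonneg {n : ℕ} {u v w : ℝ → ℝ}
    (hu : ∀ t, 0 ≤ t → AnalyticAt ℝ u t) (hv : ∀ t, 0 ≤ t → AnalyticAt ℝ v t)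
    (hu1 : ∀ t, 0 ≤ t → u (t + 1) = w t + u t) (hv1 : ∀ t, 0 ≤ t → v (t + 1) = w t + v t)
    (hu2 : ∀ t, 0 ≤ t → 0 ≤ iteratedDeriv (n + 2) u t)
    (hv2 : ∀ t, 0 ≤ t → 0 ≤ iteratedDeriv (n + 2) v t)
    (hw : Tendsto (iteratedDeriv (n + 1) w) atTop (𝓝 0)) (h0 : u 0 = v 0) {t : ℝ} (ht : 0 ≤ t) :
    u t = v t := by
  have incr : ∀ {f : ℝ → ℝ}, (∀ t, 0 ≤ t → AnalyticAt ℝ f t) →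
      (∀ t, 0 ≤ t → f (t + 1) = w t + f t) → ∀ m t, 0 < t →
      iteratedDeriv m f (t + 1) = iteratedDeriv m w t + iteratedDeriv m f t := by
    intro f hf hf1 m t ht
    -- The recurrence is only known on `[0, ∞)`, so a two-sided neighbourhood, and with it the
    -- iterated derivatives, requires `t > 0`.
    have e : w =ᶠ[𝓝 t] fun t => f (t + 1) - f t := by
      filter_upwards [lt_mem_nhds ht] with s hs
      rw [hf1 s hs.le]
      ring
    have h1 : ContDiffAt ℝ m (fun t => f (t + 1)) t :=
      ((hf (t + 1) (by linarith)).comp_of_eq (g := f) (f := fun t : ℝ => t + 1) (by fun_prop)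
        rfl).contDiffAt
    rw [e.iteratedDeriv_eq, iteratedDeriv_fun_sub h1 (hf t ht.le).contDiffAt,
      iteratedDeriv_comp_add_const]
    ring
  have mono : ∀ {f : ℝ → ℝ}, (∀ t, 0 ≤ t → AnalyticAt ℝ f t) →
      (∀ t, 0 ≤ t → 0 ≤ iteratedDeriv (n + 2) f t) →
      MonotoneOn (iteratedDeriv (n + 1) f) (Set.Ici 0) := by
    intro f hf hf2
    have hder := fun t (ht : 0 ≤ t) => hasDerivAt_iteratedDeriv (hf t ht) (n + 1)
    refine monotoneOn_of_deriv_nonneg (convex_Ici 0)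
      (fun t ht => (hder t ht).continuousAt.continuousWithinAt)
      (fun t ht => (hder t (interior_subset ht)).differentiableAt.differentiableWithinAt)
      fun t ht => ?_
    rw [(hder t (interior_subset ht)).deriv]
    exact hf2 t (interior_subset ht)
  set d : ℝ → ℝ := fun t => u t - v t with hd
  have hda : ∀ t, 0 ≤ t → AnalyticAt ℝ d t := fun t ht => (hu t ht).sub (hv t ht)
  have hdm : ∀ m t, 0 ≤ t → iteratedDeriv m d t = iteratedDeriv m u t - iteratedDeriv m v t :=
    fun m t ht => iteratedDeriv_fun_sub (hu t ht).contDiffAt (hv t ht).contDiffAt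
  have hper : ∀ m t, 0 < t → iteratedDeriv m d (t + 1) = iteratedDeriv m d t := by
    intro m t ht
    rw [hdm m t ht.le, hdm m _ (by linarith), incr hu hu1 m t ht, incr hv hv1 m t ht]
    ring
  have hperN : ∀ (N m : ℕ) t, 0 < t → iteratedDeriv m d (t + N) = iteratedDeriv m d t := by
    intro N m t ht
    induction N with
    | zero => simp
    | succ N ih =>
      have : t + ((N + 1 : ℕ) : ℝ) = t + N + 1 := by push_cast; ring
      rw [this, hper m _ (by positivity), ih]
  have hlocal : ∀ t s, 0 < t → t ≤ s → s ≤ t + 1 →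
      |iteratedDeriv (n + 1) d s - iteratedDeriv (n + 1) d t| ≤ iteratedDeriv (n + 1) w t := by
    intro t s ht h1 h2
    have hs : 0 < s := by linarith
    rw [hdm _ s hs.le, hdm _ t ht.le]
    have a1 := mono hu hu2 (Set.mem_Ici.2 ht.le) (Set.mem_Ici.2 hs.le) h1
    have a2 := mono hu hu2 (Set.mem_Ici.2 hs.le) (Set.mem_Ici.2 (by linarith : 0 ≤ t + 1)) h2
    have b1 := mono hv hv2 (Set.mem_Ici.2 ht.le) (Set.mem_Ici.2 hs.le) h1
    have b2 := mono hv hv2 (Set.mem_Ici.2 hs.le) (Set.mem_Ici.2 (by linarith : 0 ≤ t + 1)) h2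
    rw [incr hu hu1 _ t ht] at a2
    rw [incr hv hv1 _ t ht] at b2
    rw [abs_le]
    constructor <;> linarith
  have hconst : ∀ t s, 0 < t → t ≤ s → s ≤ t + 1 →
      iteratedDeriv (n + 1) d s = iteratedDeriv (n + 1) d t := by
    intro t s ht h1 h2
    have hlim : Tendsto (fun N : ℕ => iteratedDeriv (n + 1) w (t + N)) atTop (𝓝 0) :=
      hw.comp (tendsto_atTop_add_const_left _ _ tendsto_natCast_atTop_atTop)
    have hle : |iteratedDeriv (n + 1) d s - iteratedDeriv (n + 1) d t| ≤ 0 := by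
      refine ge_of_tendsto' hlim fun N => ?_
      rw [← hperN N _ s (by linarith), ← hperN N _ t ht]
      exact hlocal _ _ (by positivity) (by linarith) (by linarith)
    exact sub_eq_zero.1 (abs_nonpos_iff.1 hle)
  have hzero : ∀ t, 0 < t → iteratedDeriv (n + 1 + 1) d t = 0 := by
    intro t ht
    -- A base point with `0 < b < t < b + 1`: the window of `hconst` starting at `b` contains a
    -- neighbourhood of `t`.
    set b := max (t / 2) (t - 1 / 2)
    have hb0 : 0 < b := lt_max_of_lt_left (by linarith)
    have hbt : b < t := max_lt (by linarith) (by linarith)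
    have hbt1 : t < b + 1 := by linarith [le_max_right (t / 2) (t - 1 / 2)]
    have e : iteratedDeriv (n + 1) d =ᶠ[𝓝 t] fun _ => iteratedDeriv (n + 1) d b := by
      filter_upwards [Ioo_mem_nhds hbt hbt1] with s hs using hconst b s hb0 hs.1.le hs.2.le
    rw [iteratedDeriv_succ, e.deriv_eq, deriv_const]
  have := eq_of_periodic_of_iteratedDeriv_eq_zero hda hper hzero ht
  simp only [hd, h0, sub_self] at this
  linarith

/-- The generalized Bohr-Mollerup theorem: uniqueness of the next multiple gamma function. -/
theorem IsNextMultipleGamma.unique {n : ℕ} {g f₁ f₂ : ℂ → ℂ} (h₁ : IsNextMultipleGamma n g f₁)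
    (h₂ : IsNextMultipleGamma n g f₂)
    (hg : Tendsto (iteratedDeriv (n + 1) fun t : ℝ => Real.log (g ((t : ℂ) + 1)).re)
      atTop (𝓝 0)) : f₁ = f₂ := by
  have hne : ∀ {f : ℂ → ℂ}, IsNextMultipleGamma n g f → ∀ t : ℝ, 0 ≤ t → f ((t : ℂ) + 1) ≠ 0 := by
    intro f h t ht h0
    have := (h.pos t ht).2
    simp [h0] at this
  have han : ∀ {f : ℂ → ℂ}, IsNextMultipleGamma n g f → ∀ t : ℝ, 0 ≤ t →
      AnalyticAt ℂ f ((t : ℂ) + 1) := fun h t ht =>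
    (h.meromorphic (Set.mem_univ _)).analyticAt_of_ne_zero (hne h t ht)
  have hstep : ∀ {f : ℂ → ℂ}, IsNextMultipleGamma n g f → ∀ t : ℝ, 0 ≤ t →
      Real.log (f (((t + 1 : ℝ) : ℂ) + 1)).re
        = Real.log (g ((t : ℂ) + 1)).re + Real.log (f ((t : ℂ) + 1)).re := by
    intro f h t ht
    have e := h.map_add_one ((t : ℂ) + 1) (fun m hm => by
      have := congrArg Complex.re hm
      simp at this
      linarith [(Nat.cast_nonneg m : (0 : ℝ) ≤ m)])
    have h1 := (h.pos t ht).2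
    have h2 := (h.pos (t + 1) (by linarith)).2
    push_cast at h2 ⊢
    rw [e, Complex.mul_re, (h.pos t ht).1, mul_zero, sub_zero] at h2 ⊢
    exact Real.log_mul (pos_of_mul_pos_left h2 h1.le).ne' h1.ne'
  have hreal : ∀ t : ℝ, 0 ≤ t → f₁ ((t : ℂ) + 1) = f₂ ((t : ℂ) + 1) := by
    intro t ht
    have := eq_of_add_one_of_iteratedDeriv_nonneg
      (fun t ht => analyticAt_log_re (han h₁ t ht) (h₁.pos t ht).2)
      (fun t ht => analyticAt_log_re (han h₂ t ht) (h₂.pos t ht).2)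
      (hstep h₁) (hstep h₂) h₁.iteratedDeriv_log_nonneg h₂.iteratedDeriv_log_nonneg hg
      (by simp [h₁.map_one, h₂.map_one]) ht
    refine Complex.ext ?_ ?_
    · exact Real.log_injOn_pos (h₁.pos t ht).2 (h₂.pos t ht).2 this
    · rw [(h₁.pos t ht).1, (h₂.pos t ht).1]
  -- The point `t = 1` is interior to `[0, ∞)`, so agreement on that half-line gives agreement at
  -- real points accumulating at `2`.
  have hfreq : ∃ᶠ z in 𝓝[≠] ((1 : ℝ) + 1 : ℂ), f₁ z = f₂ z := by
    have ht : Tendsto (fun t : ℝ => (t : ℂ) + 1) (𝓝[≠] (1 : ℝ)) (𝓝[≠] ((1 : ℝ) + 1 : ℂ)) := by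
      refine tendsto_nhdsWithin_of_tendsto_nhds_of_eventually_within _ ?_ ?_
      · exact ((Complex.continuous_ofReal.add continuous_const).tendsto _).mono_left
          nhdsWithin_le_nhds
      · filter_upwards [self_mem_nhdsWithin] with t ht
        simpa using ht
    refine ht.frequently (Eventually.frequently ?_)
    filter_upwards [nhdsWithin_le_nhds (lt_mem_nhds one_pos)] with t ht using hreal t ht.le
  have hev := ((han h₁ 1 zero_le_one).frequently_eq_iff_eventually_eq (han h₂ 1 zero_le_one)).1 hfreq
  have hmer : MeromorphicOn (fun z => f₁ z - f₂ z) Set.univ :=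
    h₁.meromorphic.meromorphicOn.sub h₂.meromorphic.meromorphicOn
  have htop : meromorphicOrderAt (fun z => f₁ z - f₂ z) ((1 : ℝ) + 1 : ℂ) = ⊤ := by
    rw [meromorphicOrderAt_eq_top_iff]
    filter_upwards [nhdsWithin_le_nhds hev] with z hz using sub_eq_zero.2 hz
  funext z
  -- An infinite order of vanishing at one point propagates over the connected plane. Normal form
  -- then upgrades equality on punctured neighbourhoods to equality everywhere, poles included.
  have hz : meromorphicOrderAt (fun z => f₁ z - f₂ z) z = ⊤ := by
    by_contra hz
    exact hmer.meromorphicOrderAt_ne_top_of_isPreconnected isPreconnected_univ (Set.mem_univ z)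
      (Set.mem_univ _) hz htop
  rw [meromorphicOrderAt_eq_top_iff] at hz
  have hz' : f₁ =ᶠ[𝓝[≠] z] f₂ := hz.mono fun w hw => sub_eq_zero.1 hw
  exact ((MeromorphicNFAt.eventuallyEq_nhdsNE_iff_eventuallyEq_nhds
    (h₁.meromorphic (Set.mem_univ z)) (h₂.meromorphic (Set.mem_univ z))).1 hz').eq_of_nhds

/-! ### Canonical products with polynomial multiplicities -/

/-- A sequence of multiplicities which is polynomial of degree less than `degree`. -/
structure ProductWeight where
  /-- A strict bound for the degree. -/
  degree : ℕ
  /-- The coefficients of the polynomial. -/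
  coeff : ℕ → ℝ
  /-- The multiplicities. -/
  mult : ℕ → ℕ
  mult_eq : ∀ k : ℕ, 1 ≤ k → (mult k : ℝ) = ∑ i ∈ Finset.range degree, coeff i * (k : ℝ) ^ i

/-- Termwise differentiation of a locally uniformly convergent series of holomorphic functions. -/
lemma hasSumLocallyUniformlyOn_iteratedDeriv {F : ℕ → ℂ → ℂ} {g : ℂ → ℂ} {U : Set ℂ}
    (hU : IsOpen U) (hF : ∀ i, DifferentiableOn ℂ (F i) U) (h : HasSumLocallyUniformlyOn F g U)
    (m : ℕ) : HasSumLocallyUniformlyOn (fun i => iteratedDeriv m (F i)) (iteratedDeriv m g) U := by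
  have hFm : ∀ m i, DifferentiableOn ℂ (iteratedDeriv m (F i)) U := by
    intro m i
    induction m with
    | zero => simpa using hF i
    | succ m ih => rw [iteratedDeriv_succ]; exact ih.deriv hU
  induction m with
  | zero => simpa using h
  | succ m ih =>
    rw [hasSumLocallyUniformlyOn_iff_tendstoLocallyUniformlyOn] at ih ⊢
    simp only [iteratedDeriv_succ]
    refine (ih.deriv (.of_forall fun s => DifferentiableOn.fun_sum fun i _ => hFm m i) hU).congr
      fun s z hz => ?_
    simp only [Function.comp]
    rw [deriv_fun_sum fun i _ => ((hFm m i).differentiableAt (hU.mem_nhds hz))]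

/-- Iterated derivatives along the real line of the real part of a holomorphic function. -/
lemma iteratedDeriv_re_ofReal {g : ℂ → ℂ} {U : Set ℂ} (hU : IsOpen U)
    (hg : DifferentiableOn ℂ g U) (m : ℕ) {x : ℝ} (hx : (x : ℂ) ∈ U) :
    iteratedDeriv m (fun t : ℝ => (g t).re) x = (iteratedDeriv m g x).re := by
  have hgm : ∀ m, DifferentiableOn ℂ (iteratedDeriv m g) U := by
    intro m
    induction m with
    | zero => simpa using hg
    | succ m ih => rw [iteratedDeriv_succ]; exact ih.deriv hU
  induction m generalizing x with
  | zero => simp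
  | succ m ih =>
    rw [iteratedDeriv_succ]
    have hev : iteratedDeriv m (fun t : ℝ => (g t).re) =ᶠ[𝓝 x]
        fun t : ℝ => (iteratedDeriv m g t).re := by
      filter_upwards [Complex.continuous_ofReal.continuousAt.preimage_mem_nhds
        (hU.mem_nhds hx)] with t ht using ih ht
    rw [hev.deriv_eq, iteratedDeriv_succ]
    exact ((hgm m).differentiableAt (hU.mem_nhds hx)).hasDerivAt.real_of_complex.deriv

lemma iteratedDeriv_eval (p : Polynomial ℂ) (m : ℕ) :
    iteratedDeriv m (fun z => p.eval z) = fun z => (Polynomial.derivative^[m] p).eval z := by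
  induction m with
  | zero => simp
  | succ m ih =>
    rw [iteratedDeriv_succ, ih, Function.iterate_succ_apply']
    funext z
    exact Polynomial.deriv _

lemma iteratedDeriv_eval_eq_zero {p : Polynomial ℂ} {m : ℕ} (h : p.natDegree < m) (z : ℂ) :
    iteratedDeriv m (fun z => p.eval z) z = 0 := by
  simp only [iteratedDeriv_eval, Polynomial.iterate_derivative_eq_zero h, Polynomial.eval_zero]

lemma one_add_div_mem_slitPlane {z : ℂ} (hz : -1 < z.re) {k : ℕ} (hk : 1 ≤ k) :
    1 + z / k ∈ Complex.slitPlane := by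
  left
  have hk' : (1 : ℝ) ≤ k := by exact_mod_cast hk
  have : (1 + z / k).re = (k + z.re) / k := by
    rw [Complex.add_re, Complex.one_re, Complex.div_natCast_re]
    field_simp
  rw [this]
  apply div_pos <;> linarith

lemma isOpen_neg_one_lt_re : IsOpen {z : ℂ | -1 < z.re} :=
  isOpen_lt continuous_const Complex.continuous_re

lemma hasDerivAt_log_one_add_div {z : ℂ} (hz : -1 < z.re) {k : ℕ} (hk : 1 ≤ k) :
    HasDerivAt (fun z : ℂ => Complex.log (1 + z / k)) ((z + k)⁻¹) z := by
  have hk' : (k : ℂ) ≠ 0 := by exact_mod_cast (by omega : k ≠ 0)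
  have h := (((hasDerivAt_id z).div_const (k : ℂ)).const_add 1).clog
    (one_add_div_mem_slitPlane hz hk)
  convert! h using 1
  simp only [id]
  have h1 := Complex.slitPlane_ne_zero (one_add_div_mem_slitPlane hz hk)
  have h2 : z + k ≠ 0 := by
    intro h
    apply h1
    field_simp
    rw [add_comm, h, mul_zero]
  have h3 : (k : ℂ) + z ≠ 0 := by rwa [add_comm]
  field_simp
  ring

lemma iteratedDeriv_log_one_add_div (m : ℕ) {z : ℂ} (hz : -1 < z.re) {k : ℕ} (hk : 1 ≤ k) :
    iteratedDeriv (m + 1) (fun z : ℂ => Complex.log (1 + z / k)) z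
      = (-1) ^ m * m.factorial / (z + k) ^ (m + 1) := by
  induction m generalizing z with
  | zero => simpa using (hasDerivAt_log_one_add_div hz hk).deriv
  | succ m ih =>
    rw [iteratedDeriv_succ]
    have hev : iteratedDeriv (m + 1) (fun z : ℂ => Complex.log (1 + z / k)) =ᶠ[𝓝 z]
        fun z => (-1) ^ m * m.factorial / (z + k) ^ (m + 1) := by
      filter_upwards [isOpen_neg_one_lt_re.mem_nhds hz] with w hw using ih hw
    rw [hev.deriv_eq]
    have hne : z + k ≠ 0 := by
      intro h
      have := congrArg Complex.re h
      simp at this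
      have hk' : (1 : ℝ) ≤ k := by exact_mod_cast hk
      linarith
    have h := (((hasDerivAt_id z).add_const (k : ℂ)).pow (m + 1)).inv (pow_ne_zero _ hne)
    have h := h.const_mul ((-1 : ℂ) ^ m * m.factorial)
    simp only [div_eq_mul_inv]
    refine Eq.trans h.deriv ?_
    simp only [id, Nat.factorial_succ, Pi.pow_apply, Nat.add_sub_cancel]
    push_cast
    field_simp
    ring

lemma summable_const_mul_one_div_add_one_sq (C : ℝ) :
    Summable fun i : ℕ => C * (1 / (((i + 1 : ℕ) : ℝ)) ^ 2) :=
  ((summable_nat_add_iff 1).2 (Real.summable_one_div_nat_pow.2 one_lt_two)).mul_left C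

namespace ProductWeight

variable (W : ProductWeight)

/-- The part of `W.mult k * log (1 + z / k)` which has to be subtracted for convergence. -/
noncomputable def taylorPart (z : ℂ) (k : ℕ) : ℂ :=
  ∑ i ∈ Finset.range W.degree, W.coeff i * (k : ℂ) ^ i * Complex.logTaylor (i + 2) (z / k)

/-- The logarithm of a factor of the canonical product. -/
noncomputable def logFactor (z : ℂ) (k : ℕ) : ℂ :=
  W.mult k * Complex.log (1 + z / k) - W.taylorPart z k

/-- A factor of the canonical product. -/
noncomputable def factor (z : ℂ) (k : ℕ) : ℂ :=
  (1 + z / k) ^ W.mult k * Complex.exp (-W.taylorPart z k)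

/-- The entire function with zeros of order `W.mult k` at `-k`, as a canonical product. -/
noncomputable def canonicalProduct (z : ℂ) : ℂ := ∏' i : ℕ, W.factor z (i + 1)

/-- The logarithm of the canonical product. -/
noncomputable def logSum (z : ℂ) : ℂ := ∑' i : ℕ, W.logFactor z (i + 1)

lemma cast_mult {k : ℕ} (hk : 1 ≤ k) :
    (W.mult k : ℂ) = ∑ i ∈ Finset.range W.degree, W.coeff i * (k : ℂ) ^ i := by
  have := congrArg (fun x : ℝ => (x : ℂ)) (W.mult_eq k hk)
  push_cast at this
  exact this

/-- The monomial `k ^ i` is paired with the Taylor polynomial of degree `i + 1`, so its remainder is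
`O(k ^ i * (R / k) ^ (i + 2)) = O(k ^ (-2))`. The condition `2 * R ≤ k` gives `‖z / k‖ ≤ 1 / 2`, and
the resulting factor `2` is absorbed by the denominator `i + 2`. -/
lemma norm_logFactor_le {R : ℝ} {z : ℂ} (hz : ‖z‖ ≤ R) {k : ℕ} (hk : 1 ≤ k) (hkR : 2 * R ≤ k) :
    ‖W.logFactor z k‖
      ≤ (∑ i ∈ Finset.range W.degree, |W.coeff i| * R ^ (i + 2)) * (1 / (k : ℝ) ^ 2) := by
  have hk0 : (0 : ℝ) < k := by exact_mod_cast hk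
  have hR0 : 0 ≤ R := (norm_nonneg _).trans hz
  have hw : ‖z / k‖ ≤ R / k := by
    rw [norm_div, Complex.norm_natCast]
    gcongr
  have hw2 : ‖z / k‖ ≤ 1 / 2 := hw.trans (by rw [div_le_iff₀ hk0]; linarith)
  rw [logFactor, taylorPart, W.cast_mult hk, Finset.sum_mul, ← Finset.sum_sub_distrib,
    Finset.sum_mul]
  refine (norm_sum_le _ _).trans (Finset.sum_le_sum fun i _ => ?_)
  rw [← mul_sub, norm_mul, norm_mul, norm_pow, Complex.norm_natCast, Complex.norm_real,
    Real.norm_eq_abs]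
  have h := Complex.norm_log_sub_logTaylor_le (i + 1) (lt_of_le_of_lt hw2 (by norm_num))
  have h2 : ‖z / k‖ ^ (i + 1 + 1) * (1 - ‖z / k‖)⁻¹ / ((i + 1 : ℕ) + 1) ≤ (R / k) ^ (i + 2) := by
    have h3 : (1 - ‖z / k‖)⁻¹ ≤ 2 := by
      rw [inv_le_comm₀ (by linarith) (by norm_num)]
      linarith
    have h4 : (2 : ℝ) ≤ (i + 1 : ℕ) + 1 := by
      push_cast
      linarith [(Nat.cast_nonneg i : (0 : ℝ) ≤ i)]
    have h5 : 0 ≤ (1 - ‖z / k‖)⁻¹ := inv_nonneg.2 (by linarith)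
    calc ‖z / k‖ ^ (i + 1 + 1) * (1 - ‖z / k‖)⁻¹ / ((i + 1 : ℕ) + 1)
        ≤ (R / k) ^ (i + 2) * 2 / 2 := by gcongr
      _ = _ := by ring
  calc |W.coeff i| * (k : ℝ) ^ i * ‖_‖ ≤ |W.coeff i| * (k : ℝ) ^ i * (R / k) ^ (i + 2) := by
        gcongr
        exact h.trans h2
    _ = |W.coeff i| * R ^ (i + 2) * (1 / (k : ℝ) ^ 2) := by
        rw [div_pow, pow_add (k : ℝ) i 2]
        field_simp

lemma eventually_norm_logFactor_le (R : ℝ) : ∃ C : ℝ, ∀ᶠ i : ℕ in atTop, ∀ z : ℂ, ‖z‖ ≤ R →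
    ‖W.logFactor z (i + 1)‖ ≤ C * (1 / (((i + 1 : ℕ) : ℝ)) ^ 2) := by
  refine ⟨∑ i ∈ Finset.range W.degree, |W.coeff i| * R ^ (i + 2), ?_⟩
  filter_upwards [Filter.eventually_ge_atTop ⌈2 * R⌉₊] with i hi z hz
  refine W.norm_logFactor_le hz (by omega) ?_
  refine (Nat.le_ceil _).trans ?_
  exact_mod_cast hi.trans (Nat.le_succ i)

lemma exp_logFactor {z : ℂ} {k : ℕ} (h : 1 + z / k ≠ 0) :
    Complex.exp (W.logFactor z k) = W.factor z k := by
  rw [logFactor, factor, sub_eq_add_neg, Complex.exp_add, Complex.exp_nat_mul, Complex.exp_log h]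

lemma eventually_norm_factor_sub_one_le (R : ℝ) : ∃ C : ℝ, ∀ᶠ i : ℕ in atTop, ∀ z : ℂ, ‖z‖ ≤ R →
    ‖W.factor z (i + 1) - 1‖ ≤ C * (1 / (((i + 1 : ℕ) : ℝ)) ^ 2) := by
  obtain ⟨C, hC⟩ := W.eventually_norm_logFactor_le R
  -- The `2` comes from `‖exp w - 1‖ ≤ 2 * ‖w‖` for `‖w‖ ≤ 1`. Indices above `⌈R⌉₊` keep `1 + z / k`
  -- away from zero, so that the factor is the exponential of its logarithm.
  refine ⟨2 * C, ?_⟩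
  filter_upwards [hC, (summable_const_mul_one_div_add_one_sq C).tendsto_atTop_zero.eventually_le_const
    one_pos, eventually_gt_atTop ⌈R⌉₊] with i hi hi1 hi2 z hz
  have hne : 1 + z / ((i + 1 : ℕ) : ℂ) ≠ 0 := by
    intro h
    have h0 : ((i + 1 : ℕ) : ℂ) ≠ 0 := by exact_mod_cast Nat.succ_ne_zero i
    have h1 : z = -((i + 1 : ℕ) : ℂ) := by
      field_simp at h
      linear_combination h
    rw [h1, norm_neg, Complex.norm_natCast] at hz
    have h2 : ((i + 1 : ℕ) : ℝ) ≤ ⌈R⌉₊ := hz.trans (Nat.le_ceil R)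
    have h3 : i + 1 ≤ ⌈R⌉₊ := by exact_mod_cast h2
    omega
  rw [← W.exp_logFactor hne]
  refine (Complex.norm_exp_sub_one_le ((hi z hz).trans hi1)).trans ?_
  linarith [hi z hz]

lemma differentiable_logTaylor (n : ℕ) : Differentiable ℂ (Complex.logTaylor n) := by
  unfold Complex.logTaylor
  fun_prop

lemma differentiable_taylorPart (k : ℕ) : Differentiable ℂ fun z => W.taylorPart z k := by
  unfold taylorPart
  refine Differentiable.fun_sum fun i _ => Differentiable.const_mul ?_ _
  exact (differentiable_logTaylor _).comp (differentiable_id.div_const _)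

lemma differentiable_factor (k : ℕ) : Differentiable ℂ fun z => W.factor z k := by
  have := W.differentiable_taylorPart k
  unfold factor
  fun_prop

lemma hasProdLocallyUniformlyOn_factor (R : ℝ) : HasProdLocallyUniformlyOn
    (fun (i : ℕ) z => W.factor z (i + 1)) W.canonicalProduct (Metric.ball 0 R) := by
  obtain ⟨C, hC⟩ := W.eventually_norm_factor_sub_one_le R
  have h := Summable.hasProdLocallyUniformlyOn_nat_one_add (K := Metric.ball (0 : ℂ) R)
    (f := fun (i : ℕ) z => W.factor z (i + 1) - 1) Metric.isOpen_ball
    (summable_const_mul_one_div_add_one_sq C) ?_ ?_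
  · simp only [add_sub_cancel] at h
    exact h
  · filter_upwards [hC] with i hi z hz using hi z (mem_ball_zero_iff.1 hz).le
  · exact fun i => ((W.differentiable_factor (i + 1)).continuous.sub continuous_const).continuousOn

lemma hasProd_factor (z : ℂ) :
    HasProd (fun i : ℕ => W.factor z (i + 1)) (W.canonicalProduct z) :=
  (W.hasProdLocallyUniformlyOn_factor (‖z‖ + 1)).hasProd (by simp)

lemma differentiable_canonicalProduct : Differentiable ℂ W.canonicalProduct := by
  intro z
  have h := W.hasProdLocallyUniformlyOn_factor (‖z‖ + 1)
  rw [hasProdLocallyUniformlyOn_iff_tendstoLocallyUniformlyOn] at h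
  refine (h.differentiableOn (.of_forall fun s => ?_) Metric.isOpen_ball).differentiableAt
    (Metric.isOpen_ball.mem_nhds (by simp))
  exact (Differentiable.fun_finsetProd fun i _ => W.differentiable_factor (i + 1)).differentiableOn

lemma summable_logFactor (z : ℂ) : Summable fun i : ℕ => W.logFactor z (i + 1) := by
  obtain ⟨C, hC⟩ := W.eventually_norm_logFactor_le ‖z‖
  refine (summable_const_mul_one_div_add_one_sq C).of_norm_bounded_eventually_nat ?_
  filter_upwards [hC] with i hi using hi z le_rfl

lemma one_add_div_ne_zero {z : ℂ} {k : ℕ} (hk : 1 ≤ k) (h : z ≠ -(k : ℂ)) : 1 + z / k ≠ 0 := by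
  have hk' : (k : ℂ) ≠ 0 := by exact_mod_cast (by omega : k ≠ 0)
  intro h'
  apply h
  field_simp at h'
  linear_combination h'

/-- The principal branch suffices for every such `z`: only the exponential of each logarithm
matters, and summability depends on large `k` alone. -/
lemma canonicalProduct_eq_exp {z : ℂ} (hz : ∀ k : ℕ, 1 ≤ k → z ≠ -(k : ℂ)) :
    W.canonicalProduct z = Complex.exp (W.logSum z) := by
  have h := (W.summable_logFactor z).hasSum.cexp
  refine (W.hasProd_factor z).unique (h.congr_fun ?_)
  intro i
  exact (W.exp_logFactor (one_add_div_ne_zero (by omega) (hz _ (by omega)))).symm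

lemma differentiableOn_logFactor {k : ℕ} (hk : 1 ≤ k) :
    DifferentiableOn ℂ (fun z => W.logFactor z k) {z | -1 < z.re} := by
  intro z hz
  exact (((hasDerivAt_log_one_add_div hz hk).differentiableAt.const_mul _).sub
    (W.differentiable_taylorPart k z)).differentiableWithinAt

lemma hasSumLocallyUniformlyOn_logFactor : HasSumLocallyUniformlyOn
    (fun (i : ℕ) z => W.logFactor z (i + 1)) W.logSum {z | -1 < z.re} := by
  refine SummableLocallyUniformlyOn.hasSumLocallyUniformlyOn
    (SummableLocallyUniformlyOn.of_locally_bounded_eventually isOpen_neg_one_lt_re ?_)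
  intro K _ hK
  obtain ⟨R, hR⟩ := hK.isBounded.exists_norm_le
  obtain ⟨C, hC⟩ := W.eventually_norm_logFactor_le R
  refine ⟨_, summable_const_mul_one_div_add_one_sq C, ?_⟩
  rw [Nat.cofinite_eq_atTop]
  filter_upwards [hC] with i hi z hz using hi z (hR z hz)

lemma differentiableOn_logSum : DifferentiableOn ℂ W.logSum {z | -1 < z.re} := by
  have h := W.hasSumLocallyUniformlyOn_logFactor
  rw [hasSumLocallyUniformlyOn_iff_tendstoLocallyUniformlyOn] at h
  exact h.differentiableOn (.of_forall fun s => DifferentiableOn.fun_sum fun i _ =>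
    W.differentiableOn_logFactor (by omega)) isOpen_neg_one_lt_re

/-- `taylorPart` as a polynomial. -/
noncomputable def taylorPolynomial (k : ℕ) : Polynomial ℂ :=
  ∑ i ∈ Finset.range W.degree, ∑ j ∈ Finset.range (i + 2),
    Polynomial.C (W.coeff i * (k : ℂ) ^ i * ((-1) ^ (j + 1) / j / (k : ℂ) ^ j)) * Polynomial.X ^ j

lemma eval_taylorPolynomial (z : ℂ) (k : ℕ) :
    (W.taylorPolynomial k).eval z = W.taylorPart z k := by
  simp only [taylorPolynomial, taylorPart, Complex.logTaylor, Polynomial.eval_finsetSum,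
    Polynomial.eval_mul, Polynomial.eval_C, Polynomial.eval_pow, Polynomial.eval_X, Finset.mul_sum]
  refine Finset.sum_congr rfl fun i _ => Finset.sum_congr rfl fun j _ => ?_
  rw [div_pow]
  ring

lemma natDegree_taylorPolynomial_le (k : ℕ) : (W.taylorPolynomial k).natDegree ≤ W.degree := by
  refine Polynomial.natDegree_sum_le_of_forall_le _ _ fun i hi => ?_
  refine Polynomial.natDegree_sum_le_of_forall_le _ _ fun j hj => ?_
  refine (Polynomial.natDegree_C_mul_X_pow_le _ _).trans ?_
  have := Finset.mem_range.1 hi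
  have := Finset.mem_range.1 hj
  omega

/-- The convergence terms form a polynomial in `z` of degree at most `W.degree`, which these
derivatives annihilate. The surviving sign `(-1) ^ W.degree` is the one that `weierstrassGamma`
compensates. -/
lemma iteratedDeriv_logFactor {z : ℂ} (hz : -1 < z.re) {k : ℕ} (hk : 1 ≤ k) :
    iteratedDeriv (W.degree + 1) (fun z => W.logFactor z k) z
      = (-1) ^ W.degree * (W.mult k * W.degree.factorial / (z + k) ^ (W.degree + 1)) := by
  have h1 : ContDiffAt ℂ (W.degree + 1 : ℕ) (fun z : ℂ => Complex.log (1 + z / k)) z := by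
    exact (Complex.contDiffAt_log (one_add_div_mem_slitPlane hz hk)).comp z
      (f := fun z : ℂ => 1 + z / k) (by fun_prop)
  have h2 : ContDiffAt ℂ (W.degree + 1 : ℕ) (fun z : ℂ => W.taylorPart z k) z :=
    (W.differentiable_taylorPart k).contDiff.contDiffAt
  simp only [logFactor]
  rw [iteratedDeriv_fun_sub (contDiffAt_const.mul h1) h2, iteratedDeriv_const_mul_field,
    iteratedDeriv_log_one_add_div _ hz hk]
  simp only [← eval_taylorPolynomial]
  rw [iteratedDeriv_eval_eq_zero (Nat.lt_succ_of_le (W.natDegree_taylorPolynomial_le k))]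
  ring

lemma hasSum_iteratedDeriv_logSum {z : ℂ} (hz : -1 < z.re) :
    HasSum (fun i : ℕ => (-1) ^ W.degree * (W.mult (i + 1) * W.degree.factorial
      / (z + (i + 1 : ℕ)) ^ (W.degree + 1))) (iteratedDeriv (W.degree + 1) W.logSum z) := by
  have h := (hasSumLocallyUniformlyOn_iteratedDeriv isOpen_neg_one_lt_re
    (fun i => W.differentiableOn_logFactor (k := i + 1) (by omega))
    W.hasSumLocallyUniformlyOn_logFactor (W.degree + 1)).hasSum hz
  refine h.congr_fun fun i => ?_
  rw [W.iteratedDeriv_logFactor hz (by omega)]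


/-! ### Weierstrass products as candidates: normal form, positivity, convexity -/

variable (W : ProductWeight) (P : Polynomial ℝ)

/-- The meromorphic function `exp (P z) * (canonical product) ^ (± 1)`. -/
noncomputable def weierstrassGamma (z : ℂ) : ℂ :=
  Complex.exp (Polynomial.aeval z P) * W.canonicalProduct z ^ ((-1 : ℤ) ^ W.degree)

lemma cast_pow_neg_one (n : ℕ) : (((-1 : ℤ) ^ n : ℤ) : ℂ) = (-1) ^ n := by push_cast; rfl

/-- Integer powers of analytic functions are in normal form (the inverse of `0` being `0` at poles),
and an analytic factor without zeros preserves this. -/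
lemma meromorphicNFOn_weierstrassGamma :
    MeromorphicNFOn (fun z => W.weierstrassGamma P (z - 1)) Set.univ := by
  intro z _
  have h1 : AnalyticAt ℂ (fun z : ℂ => Complex.exp (Polynomial.aeval (z - 1) P)) z := by
    have : Differentiable ℂ fun z : ℂ => Complex.exp (Polynomial.aeval (z - 1) P) :=
      (((Polynomial.differentiable_aeval (R := ℝ) (𝕜 := ℂ) P).comp
        (differentiable_id.sub_const 1))).cexp
    exact this.analyticAt z
  have h2 : AnalyticAt ℂ (fun z : ℂ => W.canonicalProduct (z - 1)) z :=
    (W.differentiable_canonicalProduct.comp (differentiable_id.sub_const 1)).analyticAt z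
  exact (meromorphicNFAt_mul_iff_right h1 (Complex.exp_ne_zero _)).2
    (h2.meromorphicNFAt.zpow (n := (-1 : ℤ) ^ W.degree))

lemma weierstrassGamma_eq_exp {z : ℂ} (hz : ∀ k : ℕ, 1 ≤ k → z ≠ -(k : ℂ)) :
    W.weierstrassGamma P z
      = Complex.exp (Polynomial.aeval z P + (-1) ^ W.degree * W.logSum z) := by
  rw [weierstrassGamma, W.canonicalProduct_eq_exp hz, ← Complex.exp_int_mul, cast_pow_neg_one,
    Complex.exp_add]

lemma im_logFactor_ofReal {t : ℝ} (ht : -1 < t) {k : ℕ} (hk : 1 ≤ k) :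
    (W.logFactor t k).im = 0 := by
  have hk' : (1 : ℝ) ≤ k := by exact_mod_cast hk
  have h0 : 0 ≤ 1 + t / k := by
    have : 1 + t / k = (k + t) / k := by field_simp
    rw [this]
    apply div_nonneg <;> linarith
  have h1 : (1 + (t : ℂ) / k) = ((1 + t / k : ℝ) : ℂ) := by push_cast; rfl
  have h2 : W.taylorPart t k = ((∑ i ∈ Finset.range W.degree, W.coeff i * (k : ℝ) ^ i *
      ∑ j ∈ Finset.range (i + 2), (-1) ^ (j + 1) * (t / k) ^ j / j : ℝ) : ℂ) := by
    simp only [taylorPart, Complex.logTaylor]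
    push_cast
    rfl
  have h3 : W.logFactor t k = ((W.mult k * Real.log (1 + t / k) -
      ∑ i ∈ Finset.range W.degree, W.coeff i * (k : ℝ) ^ i *
      ∑ j ∈ Finset.range (i + 2), (-1) ^ (j + 1) * (t / k) ^ j / j : ℝ) : ℂ) := by
    rw [logFactor, h1, h2, ← Complex.ofReal_log h0]
    push_cast
    rfl
  rw [h3, Complex.ofReal_im]

lemma im_logSum_ofReal {t : ℝ} (ht : -1 < t) : (W.logSum t).im = 0 := by
  rw [logSum, Complex.im_tsum (W.summable_logFactor t)]
  simp [W.im_logFactor_ofReal ht]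

lemma ne_neg_natCast {t : ℝ} (ht : -1 < t) (k : ℕ) (hk : 1 ≤ k) : (t : ℂ) ≠ -(k : ℂ) := by
  intro h
  have h' : t = -(k : ℝ) := by exact_mod_cast h
  have hk' : (1 : ℝ) ≤ k := by exact_mod_cast hk
  linarith

lemma weierstrassGamma_ofReal {t : ℝ} (ht : -1 < t) :
    W.weierstrassGamma P t = (Real.exp (P.eval t + (-1) ^ W.degree * (W.logSum t).re) : ℝ) := by
  rw [W.weierstrassGamma_eq_exp P (ne_neg_natCast ht)]
  have h1 : W.logSum t = ((W.logSum t).re : ℂ) :=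
    Complex.ext (by simp) (by simp [W.im_logSum_ofReal ht])
  have h2 : (Polynomial.aeval (t : ℂ) P) = ((P.eval t : ℝ) : ℂ) := by
    have := Polynomial.aeval_algebraMap_apply (A := ℝ) ℂ t P
    simpa using this
  rw [h2]
  conv_lhs => rw [h1]
  push_cast
  rfl

/-- On the real axis the logarithm is the real part of `P + (-1) ^ degree * logSum`. The order
`W.degree + 1` annihilates `P` and the two signs cancel, so all terms are nonnegative; this is the
convexity condition. -/
lemma hasSum_iteratedDeriv_log_weierstrassGamma (hP : P.natDegree ≤ W.degree) {x : ℝ}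
    (hx : -1 < x) :
    HasSum (fun i : ℕ => W.mult (i + 1) * W.degree.factorial
        / (x + (i + 1 : ℕ)) ^ (W.degree + 1))
      (iteratedDeriv (W.degree + 1)
        (fun t : ℝ => Real.log (W.weierstrassGamma P t).re) x) := by
  have hxU : (x : ℂ) ∈ {z : ℂ | -1 < z.re} := by simpa using hx
  set g : ℂ → ℂ := fun z => (P.map (algebraMap ℝ ℂ)).eval z + (-1) ^ W.degree * W.logSum z with hg
  have hgd : DifferentiableOn ℂ g {z : ℂ | -1 < z.re} :=
    (Polynomial.differentiable _).differentiableOn.add (W.differentiableOn_logSum.const_mul _)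
  have hev : (fun t : ℝ => Real.log (W.weierstrassGamma P t).re) =ᶠ[𝓝 x] fun t => (g t).re := by
    filter_upwards [lt_mem_nhds hx] with t ht
    rw [W.weierstrassGamma_ofReal P ht, Complex.ofReal_re, Real.log_exp]
    have h1 : W.logSum t = ((W.logSum t).re : ℂ) :=
      Complex.ext (by simp) (by simp [W.im_logSum_ofReal ht])
    have h2 : (P.map (algebraMap ℝ ℂ)).eval (t : ℂ) = ((P.eval t : ℝ) : ℂ) := by
      have := Polynomial.eval_map_algebraMap P (t : ℂ)
      rw [this]
      have := Polynomial.aeval_algebraMap_apply (A := ℝ) ℂ t P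
      simpa using this
    simp only [hg, h2]
    rw [h1]
    have : ((P.eval t : ℝ) : ℂ) + (-1) ^ W.degree * ((W.logSum t).re : ℂ)
        = ((P.eval t + (-1) ^ W.degree * (W.logSum t).re : ℝ) : ℂ) := by push_cast; rfl
    rw [this, Complex.ofReal_re, Complex.ofReal_re]
  rw [hev.iteratedDeriv_eq, iteratedDeriv_re_ofReal isOpen_neg_one_lt_re hgd _ hxU]
  have hd : ContDiffAt ℂ (W.degree + 1 : ℕ) W.logSum x :=
    (W.differentiableOn_logSum.contDiffOn isOpen_neg_one_lt_re).contDiffAt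
      (isOpen_neg_one_lt_re.mem_nhds hxU)
  have hcalc : iteratedDeriv (W.degree + 1) g x
      = (-1) ^ W.degree * iteratedDeriv (W.degree + 1) W.logSum x := by
    rw [hg, iteratedDeriv_fun_add (Polynomial.differentiable _).contDiff.contDiffAt
      (contDiffAt_const.mul hd), iteratedDeriv_eval_eq_zero, iteratedDeriv_const_mul_field, zero_add]
    exact Nat.lt_succ_of_le (Polynomial.natDegree_map_le.trans hP)
  have h := (W.hasSum_iteratedDeriv_logSum (z := x) hxU).mul_left ((-1 : ℂ) ^ W.degree)
  rw [← hcalc] at h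
  have h' := Complex.hasSum_re h
  refine h'.congr_fun fun i => ?_
  have : (-1 : ℂ) ^ W.degree * ((-1) ^ W.degree * (W.mult (i + 1) * W.degree.factorial
      / ((x : ℂ) + (i + 1 : ℕ)) ^ (W.degree + 1)))
      = ((W.mult (i + 1) * W.degree.factorial / (x + (i + 1 : ℕ)) ^ (W.degree + 1) : ℝ) : ℂ) := by
    rw [← mul_assoc, ← mul_pow]
    push_cast
    simp
  rw [this, Complex.ofReal_re]

lemma exists_mult_le : ∃ C : ℝ, 0 ≤ C ∧ ∀ k : ℕ, 1 ≤ k →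
    (W.mult k : ℝ) * (k : ℝ) ≤ C * (k : ℝ) ^ W.degree := by
  refine ⟨∑ i ∈ Finset.range W.degree, |W.coeff i|, Finset.sum_nonneg fun _ _ => abs_nonneg _,
    fun k hk => ?_⟩
  have hk' : (1 : ℝ) ≤ k := by exact_mod_cast hk
  rw [W.mult_eq k hk, Finset.sum_mul, Finset.sum_mul]
  refine Finset.sum_le_sum fun i hi => ?_
  rw [mul_assoc, ← pow_succ]
  have := Finset.mem_range.1 hi
  gcongr
  · exact le_abs_self _
  · omega

/-- Supplies the decay hypothesis of the uniqueness theorem for the level above; the limit is taken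
termwise by dominated convergence. -/
lemma tendsto_iteratedDeriv_log_weierstrassGamma (hP : P.natDegree ≤ W.degree) :
    Tendsto (iteratedDeriv (W.degree + 1) fun t : ℝ => Real.log (W.weierstrassGamma P t).re)
      atTop (𝓝 0) := by
  obtain ⟨C, hC0, hC⟩ := W.exists_mult_le
  have h : Tendsto (fun x : ℝ => ∑' i : ℕ, W.mult (i + 1) * (W.degree.factorial : ℝ)
      / (x + (i + 1 : ℕ)) ^ (W.degree + 1)) atTop (𝓝 (∑' _ : ℕ, 0)) := by
    refine tendsto_tsum_of_dominated_convergence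
      (summable_const_mul_one_div_add_one_sq (C * W.degree.factorial)) ?_ ?_
    · intro i
      refine Tendsto.div_atTop tendsto_const_nhds ?_
      exact (tendsto_pow_atTop (Nat.succ_ne_zero _)).comp (tendsto_atTop_add_const_right _ _ tendsto_id)
    · filter_upwards [eventually_ge_atTop 0] with x hx i
      have hk : (0 : ℝ) < (i + 1 : ℕ) := by positivity
      rw [Real.norm_of_nonneg (by positivity)]
      -- After padding with one more factor `k`, the bound `mult k * k ≤ C * k ^ degree` makes each
      -- term at most a constant over `k ^ 2`.
      calc W.mult (i + 1) * (W.degree.factorial : ℝ) / (x + (i + 1 : ℕ)) ^ (W.degree + 1)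
          ≤ W.mult (i + 1) * (W.degree.factorial : ℝ) / ((i + 1 : ℕ) : ℝ) ^ (W.degree + 1) := by
            gcongr
            linarith
        _ = (W.mult (i + 1) * ((i + 1 : ℕ) : ℝ)) * (W.degree.factorial : ℝ)
            / ((i + 1 : ℕ) : ℝ) ^ (W.degree + 2) := by
            field_simp
            ring
        _ ≤ (C * ((i + 1 : ℕ) : ℝ) ^ W.degree) * (W.degree.factorial : ℝ)
            / ((i + 1 : ℕ) : ℝ) ^ (W.degree + 2) := by
            exact div_le_div_of_nonneg_right (mul_le_mul_of_nonneg_right (hC (i + 1) (by omega))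
              (by positivity)) (by positivity)
        _ = C * (W.degree.factorial : ℝ) * (1 / ((i + 1 : ℕ) : ℝ) ^ 2) := by
            rw [pow_add]
            field_simp
  rw [tsum_zero] at h
  refine h.congr' ?_
  filter_upwards [eventually_ge_atTop 0] with x hx
  exact (W.hasSum_iteratedDeriv_log_weierstrassGamma P hP (by linarith)).tsum_eq

lemma weierstrassGamma_zero (hP : P.coeff 0 = 0) : W.weierstrassGamma P 0 = 1 := by
  have hS : W.logSum 0 = 0 := by
    have : ∀ k : ℕ, W.logFactor 0 k = 0 := fun k => by
      simp [logFactor, taylorPart, Complex.logTaylor_at_zero]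
    simp [logSum, this]
  have h := W.weierstrassGamma_eq_exp P (z := 0) (fun k hk => by
    exact_mod_cast ne_neg_natCast (t := 0) (by norm_num) k hk)
  rw [h, hS]
  simp [Polynomial.aeval_def, Polynomial.eval₂_at_zero, hP]

/-- The Weierstrass product is the next multiple gamma function as soon as it satisfies the
functional equation. -/
lemma isNextMultipleGamma {n : ℕ} (hn : W.degree = n + 1) (hP : P.natDegree ≤ W.degree)
    (hP0 : P.coeff 0 = 0) {g : ℂ → ℂ}
    (h : ∀ z : ℂ, (∀ k : ℕ, 1 ≤ k → z ≠ -(k : ℂ)) →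
      W.weierstrassGamma P (z + 1) = g (z + 1) * W.weierstrassGamma P z) :
    IsNextMultipleGamma n g (fun z => W.weierstrassGamma P (z - 1)) where
  meromorphic := W.meromorphicNFOn_weierstrassGamma P
  map_add_one z hz := by
    have := h (z - 1) (fun k hk hzk => by
      refine hz (k - 1) ?_
      rw [Nat.cast_sub hk]
      push_cast
      linear_combination hzk)
    simpa using this
  map_one := by simpa using W.weierstrassGamma_zero P hP0
  pos x hx := by
    rw [add_sub_cancel_right, W.weierstrassGamma_ofReal P (by linarith), Complex.ofReal_im,
      Complex.ofReal_re]
    exact ⟨rfl, Real.exp_pos _⟩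
  iteratedDeriv_log_nonneg x hx := by
    simp only [add_sub_cancel_right]
    have h := W.hasSum_iteratedDeriv_log_weierstrassGamma P hP (x := x) (by linarith)
    rw [show n + 2 = W.degree + 1 by omega]
    exact h.nonneg fun i => by positivity

/-- Existence of the Weierstrass product makes the `epsilon` choice satisfy the defining conditions,
and uniqueness identifies the two. -/
lemma multipleGamma_succ_eq {n : ℕ} (hn : W.degree = n + 1) (hP : P.natDegree ≤ W.degree)
    (hP0 : P.coeff 0 = 0)
    (h : ∀ z : ℂ, (∀ k : ℕ, 1 ≤ k → z ≠ -(k : ℂ)) →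
      W.weierstrassGamma P (z + 1) = multipleGamma n (z + 1) * W.weierstrassGamma P z)
    (hlim : Tendsto (iteratedDeriv (n + 1)
      fun t : ℝ => Real.log (multipleGamma n ((t : ℂ) + 1)).re) atTop (𝓝 0)) :
    multipleGamma (n + 1) = fun z => W.weierstrassGamma P (z - 1) := by
  have h1 := W.isNextMultipleGamma P hn hP hP0 h
  have h2 : IsNextMultipleGamma n (multipleGamma n) (multipleGamma (n + 1)) :=
    Classical.epsilon_spec (p := fun f => IsNextMultipleGamma n (multipleGamma n) f) ⟨_, h1⟩
  exact h2.unique h1 hlim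


/-! ### The functional equation of canonical products -/

variable (W : ProductWeight)

/-- The logarithm of the quotient of partial products in the functional equation, up to `o(1)`. -/
noncomputable def stepLog (b : ℕ → ℕ) (q : ℕ → ℂ) (z : ℂ) (N : ℕ) : ℂ :=
  W.taylorPart (z + 1) N + W.mult N * (Real.log N : ℂ)
    - ∑ i ∈ Finset.range N, (b (i + 1) : ℂ) * (Real.log ((i : ℝ) + 1) : ℂ)
    - ∑ i ∈ Finset.range N,
      (W.taylorPart (z + 1) (i + 1) - W.taylorPart z (i + 1) + q (i + 1))

/-- An index shift: `∏ (k + z + 1) ^ mult k`, once multiplied by `∏ (k + z) ^ b k` with `b k = mult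
k - mult (k - 1)`, becomes `∏ (k + z) ^ mult k` times the boundary factor `(N + z + 1) ^ mult N`.
Dividing out nothing that depends on `z` keeps the identity valid at zeros. -/
lemma prod_factor_add_one {b : ℕ → ℕ} (q : ℕ → ℂ) (h0 : W.mult 0 = 0)
    (hb : ∀ k, W.mult (k + 1) = W.mult k + b (k + 1)) (z : ℂ) (N : ℕ) :
    (∏ i ∈ Finset.range N, W.factor (z + 1) (i + 1))
      * (∏ i ∈ Finset.range N, (1 + z / (i + 1 : ℕ)) ^ b (i + 1) * Complex.exp (-q (i + 1)))
      * ∏ i ∈ Finset.range N, ((i + 1 : ℕ) : ℂ) ^ b (i + 1)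
    = (∏ i ∈ Finset.range N, W.factor z (i + 1)) * (N + (z + 1)) ^ W.mult N
      * Complex.exp (-∑ i ∈ Finset.range N,
        (W.taylorPart (z + 1) (i + 1) - W.taylorPart z (i + 1) + q (i + 1))) := by
  induction N with
  | zero => simp [h0]
  | succ N ih =>
    simp only [Finset.prod_range_succ, Finset.sum_range_succ]
    set A := ∏ i ∈ Finset.range N, W.factor (z + 1) (i + 1)
    set B := ∏ i ∈ Finset.range N, (1 + z / (i + 1 : ℕ)) ^ b (i + 1) * Complex.exp (-q (i + 1))
    set D := ∏ i ∈ Finset.range N, ((i + 1 : ℕ) : ℂ) ^ b (i + 1)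
    set E := ∏ i ∈ Finset.range N, W.factor z (i + 1)
    set S := ∑ i ∈ Finset.range N,
        (W.taylorPart (z + 1) (i + 1) - W.taylorPart z (i + 1) + q (i + 1))
    have hk : ((N + 1 : ℕ) : ℂ) ≠ 0 := by exact_mod_cast Nat.succ_ne_zero N
    have hexp : Complex.exp (-(S + (W.taylorPart (z + 1) (N + 1) - W.taylorPart z (N + 1)
        + q (N + 1)))) * Complex.exp (-W.taylorPart z (N + 1))
        = Complex.exp (-S) * Complex.exp (-W.taylorPart (z + 1) (N + 1))
          * Complex.exp (-q (N + 1)) := by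
      rw [← Complex.exp_add, ← Complex.exp_add, ← Complex.exp_add]
      congr 1
      ring
    have hpow : (1 + (z + 1) / (N + 1 : ℕ)) ^ W.mult (N + 1)
        * ((1 + z / (N + 1 : ℕ)) ^ b (N + 1) * ((N + 1 : ℕ) : ℂ) ^ b (N + 1))
        * (N + (z + 1)) ^ W.mult N
        = (1 + z / (N + 1 : ℕ)) ^ W.mult (N + 1)
          * (((N + 1 : ℕ) : ℂ) + (z + 1)) ^ W.mult (N + 1) := by
      have e1 : (1 + z / (N + 1 : ℕ)) * ((N + 1 : ℕ) : ℂ) = N + (z + 1) := by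
        rw [add_mul, div_mul_cancel₀ _ hk]
        push_cast
        ring
      rw [← mul_pow, e1, mul_assoc, ← pow_add, add_comm (b (N + 1)), ← hb, ← mul_pow, ← mul_pow,
        ← e1]
      congr 1
      field_simp
    simp only [factor]
    linear_combination (1 + (z + 1) / (N + 1 : ℕ)) ^ W.mult (N + 1)
        * Complex.exp (-W.taylorPart (z + 1) (N + 1))
        * ((1 + z / (N + 1 : ℕ)) ^ b (N + 1) * Complex.exp (-q (N + 1)))
        * ((N + 1 : ℕ) : ℂ) ^ b (N + 1) * ih
      + E * Complex.exp (-S) * Complex.exp (-W.taylorPart (z + 1) (N + 1))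
        * Complex.exp (-q (N + 1)) * hpow
      - E * (1 + z / (N + 1 : ℕ)) ^ W.mult (N + 1)
          * (((N + 1 : ℕ) : ℂ) + (z + 1)) ^ W.mult (N + 1) * hexp

/-- The functional equation of canonical products. -/
lemma canonicalProduct_add_one_mul {b : ℕ → ℕ} {q : ℕ → ℂ} (h0 : W.mult 0 = 0)
    (hb : ∀ k, W.mult (k + 1) = W.mult k + b (k + 1)) {z G c : ℂ}
    (hz : ∀ k : ℕ, 1 ≤ k → z ≠ -(k : ℂ))
    (hG : HasProd (fun i : ℕ => (1 + z / (i + 1 : ℕ)) ^ b (i + 1) * Complex.exp (-q (i + 1))) G)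
    (hc : Tendsto (W.stepLog b q z) atTop (𝓝 c)) :
    W.canonicalProduct (z + 1) * G = W.canonicalProduct z * Complex.exp c := by
  have h1 := ((W.hasProd_factor (z + 1)).tendsto_prod_nat).mul hG.tendsto_prod_nat
  -- The boundary factor is `N ^ mult N * (1 + (z + 1) / N) ^ mult N`. The logarithm of the second
  -- part is `logFactor + taylorPart`, and `logFactor` tends to `0` as the term of a convergent
  -- series.
  have hlf : Tendsto (fun N : ℕ => W.logFactor (z + 1) N) atTop (𝓝 0) := by
    have := (W.summable_logFactor (z + 1)).tendsto_atTop_zero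
    exact (tendsto_add_atTop_iff_nat (f := fun N : ℕ => W.logFactor (z + 1) N) 1).1 this
  have h2 := ((W.hasProd_factor z).tendsto_prod_nat).mul ((hlf.add hc).cexp)
  rw [zero_add] at h2
  refine tendsto_nhds_unique h1 (h2.congr' ?_)
  filter_upwards [eventually_ge_atTop 1] with N hN
  have hD : ∏ i ∈ Finset.range N, ((i + 1 : ℕ) : ℂ) ^ b (i + 1)
      = Complex.exp (∑ i ∈ Finset.range N, (b (i + 1) : ℂ) * (Real.log ((i : ℝ) + 1) : ℂ)) := by
    rw [Complex.exp_sum]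
    refine Finset.prod_congr rfl fun i _ => ?_
    rw [Complex.exp_nat_mul, Complex.ofReal_log (by positivity)]
    push_cast
    rw [Complex.exp_log (by exact_mod_cast Nat.succ_ne_zero i)]
  have hNne : (N : ℂ) ≠ 0 := by exact_mod_cast (by omega : N ≠ 0)
  have hne : 1 + (z + 1) / N ≠ 0 := one_add_div_ne_zero hN fun h => by
    refine hz (N + 1) (by omega) ?_
    push_cast
    linear_combination h
  have hN' : (N + (z + 1)) ^ W.mult N
      = Complex.exp (W.mult N * (Real.log N : ℂ) + W.mult N * Complex.log (1 + (z + 1) / N)) := by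
    rw [Complex.exp_add, Complex.exp_nat_mul, Complex.exp_nat_mul, Complex.exp_log hne,
      Complex.ofReal_log (by positivity), ← mul_pow]
    push_cast
    rw [Complex.exp_log hNne]
    congr 1
    field_simp
  have key := W.prod_factor_add_one q h0 hb z N
  rw [hD, hN'] at key
  have hDne := Complex.exp_ne_zero
    (∑ i ∈ Finset.range N, (b (i + 1) : ℂ) * (Real.log ((i : ℝ) + 1) : ℂ))
  refine mul_right_cancel₀ hDne ?_
  rw [key, mul_assoc, mul_assoc, ← Complex.exp_add, ← Complex.exp_add]
  congr 2
  simp only [stepLog, logFactor]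
  ring

lemma canonicalProduct_ne_zero {z : ℂ} (hz : ∀ k : ℕ, 1 ≤ k → z ≠ -(k : ℂ)) :
    W.canonicalProduct z ≠ 0 := by
  rw [W.canonicalProduct_eq_exp hz]
  exact Complex.exp_ne_zero _

/-- The functional equation between consecutive levels. -/
lemma weierstrassGamma_add_one (V : ProductWeight) (P Q : Polynomial ℝ)
    (hdeg : W.degree = V.degree + 1) (h0 : W.mult 0 = 0)
    (hb : ∀ k, W.mult (k + 1) = W.mult k + V.mult (k + 1)) {z : ℂ}
    (hz : ∀ k : ℕ, 1 ≤ k → z ≠ -(k : ℂ))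
    (hc : Tendsto (W.stepLog V.mult (V.taylorPart z) z) atTop (𝓝 ((-1) ^ W.degree *
      (Polynomial.aeval z Q + Polynomial.aeval z P - Polynomial.aeval (z + 1) P)))) :
    W.weierstrassGamma P (z + 1) = V.weierstrassGamma Q z * W.weierstrassGamma P z := by
  have key := W.canonicalProduct_add_one_mul h0 hb hz (V.hasProd_factor z) hc
  have hV := V.canonicalProduct_ne_zero hz
  have key' : W.canonicalProduct (z + 1) = W.canonicalProduct z * (V.canonicalProduct z)⁻¹ *
      Complex.exp ((-1) ^ W.degree *
      (Polynomial.aeval z Q + Polynomial.aeval z P - Polynomial.aeval (z + 1) P)) := by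
    field_simp
    exact key
  simp only [weierstrassGamma]
  rw [key', mul_zpow, mul_zpow, ← Complex.exp_int_mul, cast_pow_neg_one, ← mul_assoc ((-1 : ℂ) ^ _),
    ← mul_pow]
  -- Consecutive degrees have opposite signs, so the lower product, which enters inverted, acquires
  -- the exponent prescribed for its own level.
  have hinv : (V.canonicalProduct z)⁻¹ ^ ((-1 : ℤ) ^ W.degree)
      = V.canonicalProduct z ^ ((-1 : ℤ) ^ V.degree) := by
    rw [inv_zpow', hdeg, pow_succ]
    simp
  rw [hinv]
  have hexp : Complex.exp (Polynomial.aeval (z + 1) P) * Complex.exp ((-1 * -1) ^ W.degree *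
      (Polynomial.aeval z Q + Polynomial.aeval z P - Polynomial.aeval (z + 1) P))
      = Complex.exp (Polynomial.aeval z Q) * Complex.exp (Polynomial.aeval z P) := by
    rw [← Complex.exp_add, ← Complex.exp_add]
    congr 1
    norm_num
  linear_combination (W.canonicalProduct z ^ ((-1 : ℤ) ^ W.degree)
    * V.canonicalProduct z ^ ((-1 : ℤ) ^ V.degree)) * hexp

end ProductWeight

/-! ### Power sums and harmonic numbers -/

section PowerSums

lemma sum_add_one_range (N : ℕ) :
    ∑ i ∈ Finset.range N, ((i : ℂ) + 1) = (N : ℂ) * ((N : ℂ) + 1) / 2 := by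
  induction N with
  | zero => simp
  | succ N ih => rw [Finset.sum_range_succ, ih]; push_cast; ring

lemma sum_add_one_sq_range (N : ℕ) :
    ∑ i ∈ Finset.range N, ((i : ℂ) + 1) ^ 2 = (N : ℂ) * ((N : ℂ) + 1) * (2 * (N : ℂ) + 1) / 6 := by
  induction N with
  | zero => simp
  | succ N ih => rw [Finset.sum_range_succ, ih]; push_cast; ring

lemma sum_add_one_cube_range (N : ℕ) :
    ∑ i ∈ Finset.range N, ((i : ℂ) + 1) ^ 3 = ((N : ℂ) * ((N : ℂ) + 1) / 2) ^ 2 := by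
  induction N with
  | zero => simp
  | succ N ih => rw [Finset.sum_range_succ, ih]; push_cast; ring

/-- A sum of quotients of powers. -/
noncomputable def powQuotientSum (l j N : ℕ) : ℂ :=
  ∑ i ∈ Finset.range N, ((i : ℂ) + 1) ^ l / (i + 1) ^ j

lemma powQuotientSum_add (l j N : ℕ) :
    powQuotientSum (l + j) j N = ∑ i ∈ Finset.range N, ((i : ℂ) + 1) ^ l := by
  refine Finset.sum_congr rfl fun i _ => ?_
  have : (i : ℂ) + 1 ≠ 0 := by exact_mod_cast Nat.succ_ne_zero i
  rw [pow_add, mul_div_cancel_right₀ _ (pow_ne_zero _ this)]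

lemma powQuotientSum_self (l N : ℕ) : powQuotientSum l l N = N := by
  have := powQuotientSum_add 0 l N
  simpa using this

lemma powQuotientSum_add_one (l N : ℕ) :
    powQuotientSum (1 + l) l N = (N : ℂ) * ((N : ℂ) + 1) / 2 := by
  rw [powQuotientSum_add, ← sum_add_one_range]
  simp

lemma powQuotientSum_add_two (l N : ℕ) :
    powQuotientSum (2 + l) l N = (N : ℂ) * ((N : ℂ) + 1) * (2 * (N : ℂ) + 1) / 6 := by
  rw [powQuotientSum_add, sum_add_one_sq_range]

lemma powQuotientSum_add_three (l N : ℕ) :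
    powQuotientSum (3 + l) l N = ((N : ℂ) * ((N : ℂ) + 1) / 2) ^ 2 := by
  rw [powQuotientSum_add, sum_add_one_cube_range]

lemma powQuotientSum_succ_right (l N : ℕ) :
    powQuotientSum l (l + 1) N = (harmonic N : ℂ) := by
  rw [harmonic]
  push_cast
  refine Finset.sum_congr rfl fun i _ => ?_
  have : (i : ℂ) + 1 ≠ 0 := by exact_mod_cast Nat.succ_ne_zero i
  rw [pow_succ]
  field_simp

/-- The sums `∑ (i + 1) ^ (l - j) * z ^ j` which occur in sums of Taylor parts. -/
lemma sum_pow_mul_logTaylor (l : ℕ) (z : ℂ) (N : ℕ) :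
    ∑ i ∈ Finset.range N, ((i : ℂ) + 1) ^ l * Complex.logTaylor (l + 2) (z / (i + 1))
      = ∑ j ∈ Finset.range (l + 1), (-1) ^ j * z ^ (j + 1) / (j + 1)
        * powQuotientSum l (j + 1) N := by
  simp only [powQuotientSum, Complex.logTaylor, Finset.mul_sum]
  rw [Finset.sum_comm, Finset.sum_range_succ']
  simp only [Nat.cast_zero, div_zero, mul_zero, Finset.sum_const_zero, add_zero]
  refine Finset.sum_congr rfl fun j _ => Finset.sum_congr rfl fun i _ => ?_
  rw [div_pow, pow_add (-1 : ℂ) (j + 1) 1, pow_succ (-1 : ℂ) j]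
  push_cast
  ring

end PowerSums

lemma tendsto_harmonic_sub_log_sub :
    Tendsto (fun N : ℕ => (harmonic N : ℂ) - (Real.log N : ℂ)
      - (Real.eulerMascheroniConstant : ℂ)) atTop (𝓝 0) := by
  have h := (Complex.continuous_ofReal.tendsto _).comp
    (Real.tendsto_harmonic_sub_log.sub_const Real.eulerMascheroniConstant)
  simpa [Function.comp_def] using h

/-! ### Multiplicities of the first five levels -/

/-- The multiplicities `1` of the gamma function. -/
noncomputable def weightOne : ProductWeight where
  degree := 1
  coeff _ := 1
  -- The value `0` at `k = 0` is what starts the index shift in the functional equation.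
  mult k := if k = 0 then 0 else 1
  mult_eq k hk := by simp [show k ≠ 0 by omega]

/-- The multiplicities `k` of the Barnes `G`-function. -/
noncomputable def weightTwo : ProductWeight where
  degree := 2
  coeff i := if i = 1 then 1 else 0
  mult k := k
  mult_eq k hk := by simp

/-- The multiplicities of `G_3`. -/
noncomputable def weightThree : ProductWeight where
  degree := 3
  coeff i := if i = 1 then 1 / 2 else if i = 2 then 1 / 2 else 0
  mult k := (k + 1).choose 2
  mult_eq k hk := by
    simp only [Finset.sum_range_succ, Finset.sum_range_zero]
    rw [Nat.cast_choose_two]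
    push_cast
    norm_num
    ring

lemma two_mul_choose (k : ℕ) : (2 * (k + 1).choose 2 : ℤ) = k * (k + 1) := by
  induction k with
  | zero => simp
  | succ k ih =>
    rw [Nat.choose_succ_succ', Nat.choose_one_right]
    push_cast
    linear_combination ih

/-- Pascal's rule reduces the step to the previous identity. The form over `ℤ` gives both the
polynomial coefficients and the exactness of the division in the exponents. -/
lemma six_mul_choose (k : ℕ) : (6 * (k + 2).choose 3 : ℤ) = k * (k + 1) * (k + 2) := by
  induction k with
  | zero => simp
  | succ k ih =>
    rw [show k + 1 + 2 = (k + 2) + 1 by ring, Nat.choose_succ_succ']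
    have := two_mul_choose (k + 1)
    push_cast at this ⊢
    linear_combination ih + 3 * this

lemma twentyfour_mul_choose (k : ℕ) :
    (24 * (k + 3).choose 4 : ℤ) = k * (k + 1) * (k + 2) * (k + 3) := by
  induction k with
  | zero => simp
  | succ k ih =>
    rw [show k + 1 + 3 = (k + 3) + 1 by ring, Nat.choose_succ_succ']
    have := six_mul_choose (k + 1)
    push_cast at this ⊢
    linear_combination ih + 4 * this

/-- The multiplicities of `G_4`. -/
noncomputable def weightFour : ProductWeight where
  degree := 4
  coeff i := if i = 1 then 1 / 3 else if i = 2 then 1 / 2 else if i = 3 then 1 / 6 else 0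
  mult k := (k + 2).choose 3
  mult_eq k hk := by
    have h := congrArg (fun x : ℤ => (x : ℝ)) (six_mul_choose k)
    simp only [Finset.sum_range_succ, Finset.sum_range_zero]
    push_cast at h ⊢
    norm_num
    linear_combination h / 6

/-- The multiplicities of `G_5`. -/
noncomputable def weightFive : ProductWeight where
  degree := 5
  coeff i := if i = 1 then 1 / 4 else if i = 2 then 11 / 24 else if i = 3 then 1 / 4 else
    if i = 4 then 1 / 24 else 0
  mult k := (k + 3).choose 4
  mult_eq k hk := by
    have h := congrArg (fun x : ℤ => (x : ℝ)) (twentyfour_mul_choose k)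
    simp only [Finset.sum_range_succ, Finset.sum_range_zero]
    push_cast at h ⊢
    norm_num
    linear_combination h / 24

/-! ### Exponent polynomials -/

section Exponents

open Polynomial

/-- The real number `ζ'(-j)`. -/
noncomputable def zetaDeriv (j : ℕ) : ℝ := (deriv riemannZeta (-j)).re

local notation "γ" => Real.eulerMascheroniConstant

/-- The exponent polynomial of `G_1`. -/
noncomputable def exponentOne : ℝ[X] := C (-γ) * X

/-- The exponent polynomial of `G_2`. -/
noncomputable def exponentTwo : ℝ[X] := C (-(1 + γ) / 2) * X ^ 2 + C (-zetaDeriv 0 - 1 / 2) * X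

/-- The exponent polynomial of `G_3`. -/
noncomputable def exponentThree : ℝ[X] := C (-1 / 4 - γ / 6) * X ^ 3
  + C (1 / 8 - zetaDeriv 0 / 2 + γ / 4) * X ^ 2 + C (7 / 24 + zetaDeriv 1 + zetaDeriv 0 / 2) * X

/-- The exponent polynomial of `G_4`. -/
noncomputable def exponentFour : ℝ[X] := C (-11 / 144 - γ / 24) * X ^ 4
  + C (2 / 9 - zetaDeriv 0 / 6 + γ / 6) * X ^ 3
  + C (-5 / 144 + zetaDeriv 1 / 2 + zetaDeriv 0 / 2 - γ / 6) * X ^ 2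
  + C (-5 / 24 - zetaDeriv 2 / 2 - zetaDeriv 1 - zetaDeriv 0 / 3) * X

/-- The exponent polynomial of `G_5`. -/
noncomputable def exponentFive : ℝ[X] := C (-5 / 288 - γ / 120) * X ^ 5
  + C (7 / 64 - zetaDeriv 0 / 24 + γ / 16) * X ^ 4
  + C (-161 / 864 + zetaDeriv 1 / 6 + zetaDeriv 0 / 4 - 11 * γ / 72) * X ^ 3
  + C (-zetaDeriv 2 / 4 - 3 * zetaDeriv 1 / 4 - 11 * zetaDeriv 0 / 24 + γ / 8) * X ^ 2
  + C (469 / 2880 + zetaDeriv 3 / 6 + 3 * zetaDeriv 2 / 4 + 11 * zetaDeriv 1 / 12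
    + zetaDeriv 0 / 4) * X

lemma natDegree_exponentOne_le : exponentOne.natDegree ≤ 1 := by
  unfold exponentOne; compute_degree
lemma natDegree_exponentTwo_le : exponentTwo.natDegree ≤ 2 := by
  unfold exponentTwo; compute_degree
lemma natDegree_exponentThree_le : exponentThree.natDegree ≤ 3 := by
  unfold exponentThree; compute_degree
lemma natDegree_exponentFour_le : exponentFour.natDegree ≤ 4 := by
  unfold exponentFour; compute_degree
lemma natDegree_exponentFive_le : exponentFive.natDegree ≤ 5 := by
  unfold exponentFive; compute_degree

lemma coeff_exponentOne_zero : exponentOne.coeff 0 = 0 := by simp [exponentOne]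
lemma coeff_exponentTwo_zero : exponentTwo.coeff 0 = 0 := by simp [exponentTwo]
lemma coeff_exponentThree_zero : exponentThree.coeff 0 = 0 := by simp [exponentThree]
lemma coeff_exponentFour_zero : exponentFour.coeff 0 = 0 := by simp [exponentFour]
lemma coeff_exponentFive_zero : exponentFive.coeff 0 = 0 := by simp [exponentFive]

lemma aeval_exponentOne (z : ℂ) : aeval z exponentOne = -(γ : ℂ) * z := by
  simp [exponentOne]
lemma aeval_exponentTwo (z : ℂ) : aeval z exponentTwo =
    -(1 + (γ : ℂ)) / 2 * z ^ 2 + (-(zetaDeriv 0 : ℂ) - 1 / 2) * z := by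
  simp [exponentTwo]
lemma aeval_exponentThree (z : ℂ) : aeval z exponentThree =
    (-1 / 4 - (γ : ℂ) / 6) * z ^ 3 + (1 / 8 - (zetaDeriv 0 : ℂ) / 2 + (γ : ℂ) / 4) * z ^ 2
      + (7 / 24 + (zetaDeriv 1 : ℂ) + (zetaDeriv 0 : ℂ) / 2) * z := by
  simp [exponentThree]
lemma aeval_exponentFour (z : ℂ) : aeval z exponentFour =
    (-11 / 144 - (γ : ℂ) / 24) * z ^ 4 + (2 / 9 - (zetaDeriv 0 : ℂ) / 6 + (γ : ℂ) / 6) * z ^ 3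
      + (-5 / 144 + (zetaDeriv 1 : ℂ) / 2 + (zetaDeriv 0 : ℂ) / 2 - (γ : ℂ) / 6) * z ^ 2
      + (-5 / 24 - (zetaDeriv 2 : ℂ) / 2 - (zetaDeriv 1 : ℂ) - (zetaDeriv 0 : ℂ) / 3) * z := by
  simp [exponentFour]
lemma aeval_exponentFive (z : ℂ) : aeval z exponentFive =
    (-5 / 288 - (γ : ℂ) / 120) * z ^ 5 + (7 / 64 - (zetaDeriv 0 : ℂ) / 24 + (γ : ℂ) / 16) * z ^ 4
      + (-161 / 864 + (zetaDeriv 1 : ℂ) / 6 + (zetaDeriv 0 : ℂ) / 4 - 11 * (γ : ℂ) / 72) * z ^ 3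
      + (-(zetaDeriv 2 : ℂ) / 4 - 3 * (zetaDeriv 1 : ℂ) / 4 - 11 * (zetaDeriv 0 : ℂ) / 24
        + (γ : ℂ) / 8) * z ^ 2
      + (469 / 2880 + (zetaDeriv 3 : ℂ) / 6 + 3 * (zetaDeriv 2 : ℂ) / 4
        + 11 * (zetaDeriv 1 : ℂ) / 12 + (zetaDeriv 0 : ℂ) / 4) * z := by
  simp [exponentFive]

end Exponents

/-! ### Complex form of the logarithmic sums -/

/-- The sum `∑ k ^ j * log k` up to `N`. -/
noncomputable def powLogSum (j N : ℕ) : ℝ :=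
  ∑ k ∈ Finset.range N, ((k : ℝ) + 1) ^ j * Real.log ((k : ℝ) + 1)

lemma tendsto_powLogSum_zero : Tendsto (fun N : ℕ => (powLogSum 0 N : ℂ)
    - (((N : ℂ) + 1 / 2) * (Real.log N : ℂ) - N) + zetaDeriv 0) atTop (𝓝 0) := by
  have h := (Complex.continuous_ofReal.tendsto _).comp tendsto_sum_log
  simpa [Function.comp_def, powLogSum, zetaDeriv] using h

lemma tendsto_powLogSum_one : Tendsto (fun N : ℕ => (powLogSum 1 N : ℂ)
    - (((N : ℂ) ^ 2 / 2 + N / 2 + 1 / 12) * (Real.log N : ℂ) - (N : ℂ) ^ 2 / 4 + 1 / 12)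
    + zetaDeriv 1) atTop (𝓝 0) := by
  have h := (Complex.continuous_ofReal.tendsto _).comp tendsto_sum_mul_log
  simpa [Function.comp_def, powLogSum, zetaDeriv] using h

lemma tendsto_powLogSum_two : Tendsto (fun N : ℕ => (powLogSum 2 N : ℂ)
    - (((N : ℂ) ^ 3 / 3 + (N : ℂ) ^ 2 / 2 + N / 6) * (Real.log N : ℂ) - (N : ℂ) ^ 3 / 9 + N / 12)
    + zetaDeriv 2) atTop (𝓝 0) := by
  have h := (Complex.continuous_ofReal.tendsto _).comp tendsto_sum_sq_mul_log
  simpa [Function.comp_def, powLogSum, zetaDeriv] using h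

lemma tendsto_powLogSum_three : Tendsto (fun N : ℕ => (powLogSum 3 N : ℂ)
    - (((N : ℂ) ^ 4 / 4 + (N : ℂ) ^ 3 / 2 + (N : ℂ) ^ 2 / 4 - 1 / 120) * (Real.log N : ℂ)
      - (N : ℂ) ^ 4 / 16 + (N : ℂ) ^ 2 / 12 - 11 / 720) + zetaDeriv 3) atTop (𝓝 0) := by
  have h := (Complex.continuous_ofReal.tendsto _).comp tendsto_sum_cube_mul_log
  simpa [Function.comp_def, powLogSum, zetaDeriv] using h

/-! ### Evaluation of the exponential factor in the functional equation -/

namespace ProductWeight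

variable (W : ProductWeight)

/-- For `j < l` the inner sums are polynomials in `N`; the top term `j = l` produces the harmonic
number. -/
lemma sum_taylorPart (z : ℂ) (N : ℕ) :
    ∑ i ∈ Finset.range N, W.taylorPart z (i + 1)
      = ∑ l ∈ Finset.range W.degree, (W.coeff l : ℂ) *
        ∑ j ∈ Finset.range (l + 1), (-1) ^ j * z ^ (j + 1) / (j + 1)
        * powQuotientSum l (j + 1) N := by
  simp only [taylorPart]
  rw [Finset.sum_comm]
  refine Finset.sum_congr rfl fun l _ => ?_
  rw [← sum_pow_mul_logTaylor, Finset.mul_sum]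
  push_cast
  simp only [mul_assoc]

lemma sum_mult_mul_log (N : ℕ) :
    ∑ i ∈ Finset.range N, (W.mult (i + 1) : ℂ) * (Real.log ((i : ℝ) + 1) : ℂ)
      = ∑ l ∈ Finset.range W.degree, (W.coeff l : ℂ) *
        (powLogSum l N : ℂ) := by
  simp only [powLogSum]
  push_cast
  simp only [Finset.mul_sum]
  rw [Finset.sum_comm]
  refine Finset.sum_congr rfl fun i _ => ?_
  rw [W.cast_mult (by omega), Finset.sum_mul]
  push_cast
  simp only [mul_assoc]


lemma sum_taylorPart_one (z : ℂ) (N : ℕ) :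
    ∑ i ∈ Finset.range N, weightOne.taylorPart z (i + 1) = z * (harmonic N : ℂ) := by
  rw [sum_taylorPart]
  simp [weightOne, Finset.sum_range_succ, powQuotientSum_succ_right 0]

lemma sum_taylorPart_two (z : ℂ) (N : ℕ) :
    ∑ i ∈ Finset.range N, weightTwo.taylorPart z (i + 1) =
      1 * (z ^ 1 / 1 * (N : ℂ) - z ^ 2 / 2 * (harmonic N : ℂ)) := by
  have h0 := powQuotientSum_self 1 N
  have h1 := powQuotientSum_succ_right 1 N
  norm_num at h0 h1
  rw [sum_taylorPart]
  norm_num [weightTwo, Finset.sum_range_succ, h0, h1]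
  ring

lemma taylorPart_two (z : ℂ) {N : ℕ} (hN : (N : ℂ) ≠ 0) :
    weightTwo.taylorPart z N =
      1 * (z ^ 1 / 1 * (N : ℂ) ^ 0 - z ^ 2 / 2 * (N : ℂ)⁻¹) := by
  simp only [taylorPart, Complex.logTaylor]
  norm_num [weightTwo, Finset.sum_range_succ]
  field_simp
  ring

lemma sum_taylorPart_three (z : ℂ) (N : ℕ) :
    ∑ i ∈ Finset.range N, weightThree.taylorPart z (i + 1) =
      1 / 2 * (z ^ 1 / 1 * (N : ℂ) - z ^ 2 / 2 * (harmonic N : ℂ))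
      + 1 / 2 * (z ^ 1 / 1 * ((N : ℂ) * ((N : ℂ) + 1) / 2) - z ^ 2 / 2 * (N : ℂ) + z ^ 3 / 3 * (harmonic N : ℂ)) := by
  have h0 := powQuotientSum_self 1 N
  have h1 := powQuotientSum_succ_right 1 N
  have h2 := powQuotientSum_add_one 1 N
  have h3 := powQuotientSum_self 2 N
  have h4 := powQuotientSum_succ_right 2 N
  norm_num at h0 h1 h2 h3 h4
  rw [sum_taylorPart]
  norm_num [weightThree, Finset.sum_range_succ, h0, h1, h2, h3, h4]
  ring

lemma taylorPart_three (z : ℂ) {N : ℕ} (hN : (N : ℂ) ≠ 0) :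
    weightThree.taylorPart z N =
      1 / 2 * (z ^ 1 / 1 * (N : ℂ) ^ 0 - z ^ 2 / 2 * (N : ℂ)⁻¹)
      + 1 / 2 * (z ^ 1 / 1 * (N : ℂ) ^ 1 - z ^ 2 / 2 * (N : ℂ) ^ 0 + z ^ 3 / 3 * (N : ℂ)⁻¹) := by
  simp only [taylorPart, Complex.logTaylor]
  norm_num [weightThree, Finset.sum_range_succ]
  field_simp
  ring

lemma sum_taylorPart_four (z : ℂ) (N : ℕ) :
    ∑ i ∈ Finset.range N, weightFour.taylorPart z (i + 1) =
      1 / 3 * (z ^ 1 / 1 * (N : ℂ) - z ^ 2 / 2 * (harmonic N : ℂ))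
      + 1 / 2 * (z ^ 1 / 1 * ((N : ℂ) * ((N : ℂ) + 1) / 2) - z ^ 2 / 2 * (N : ℂ) + z ^ 3 / 3 * (harmonic N : ℂ))
      + 1 / 6 * (z ^ 1 / 1 * ((N : ℂ) * ((N : ℂ) + 1) * (2 * (N : ℂ) + 1) / 6) - z ^ 2 / 2 * ((N : ℂ) * ((N : ℂ) + 1) / 2) + z ^ 3 / 3 * (N : ℂ) - z ^ 4 / 4 * (harmonic N : ℂ)) := by
  have h0 := powQuotientSum_self 1 N
  have h1 := powQuotientSum_succ_right 1 N
  have h2 := powQuotientSum_add_one 1 N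
  have h3 := powQuotientSum_self 2 N
  have h4 := powQuotientSum_succ_right 2 N
  have h5 := powQuotientSum_add_two 1 N
  have h6 := powQuotientSum_add_one 2 N
  have h7 := powQuotientSum_self 3 N
  have h8 := powQuotientSum_succ_right 3 N
  norm_num at h0 h1 h2 h3 h4 h5 h6 h7 h8
  rw [sum_taylorPart]
  norm_num [weightFour, Finset.sum_range_succ, h0, h1, h2, h3, h4, h5, h6, h7, h8]
  ring

lemma taylorPart_four (z : ℂ) {N : ℕ} (hN : (N : ℂ) ≠ 0) :
    weightFour.taylorPart z N =
      1 / 3 * (z ^ 1 / 1 * (N : ℂ) ^ 0 - z ^ 2 / 2 * (N : ℂ)⁻¹)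
      + 1 / 2 * (z ^ 1 / 1 * (N : ℂ) ^ 1 - z ^ 2 / 2 * (N : ℂ) ^ 0 + z ^ 3 / 3 * (N : ℂ)⁻¹)
      + 1 / 6 * (z ^ 1 / 1 * (N : ℂ) ^ 2 - z ^ 2 / 2 * (N : ℂ) ^ 1 + z ^ 3 / 3 * (N : ℂ) ^ 0 - z ^ 4 / 4 * (N : ℂ)⁻¹) := by
  simp only [taylorPart, Complex.logTaylor]
  norm_num [weightFour, Finset.sum_range_succ]
  field_simp
  ring

lemma sum_taylorPart_five (z : ℂ) (N : ℕ) :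
    ∑ i ∈ Finset.range N, weightFive.taylorPart z (i + 1) =
      1 / 4 * (z ^ 1 / 1 * (N : ℂ) - z ^ 2 / 2 * (harmonic N : ℂ))
      + 11 / 24 * (z ^ 1 / 1 * ((N : ℂ) * ((N : ℂ) + 1) / 2) - z ^ 2 / 2 * (N : ℂ) + z ^ 3 / 3 * (harmonic N : ℂ))
      + 1 / 4 * (z ^ 1 / 1 * ((N : ℂ) * ((N : ℂ) + 1) * (2 * (N : ℂ) + 1) / 6) - z ^ 2 / 2 * ((N : ℂ) * ((N : ℂ) + 1) / 2) + z ^ 3 / 3 * (N : ℂ) - z ^ 4 / 4 * (harmonic N : ℂ))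
      + 1 / 24 * (z ^ 1 / 1 * ((N : ℂ) * ((N : ℂ) + 1) / 2) ^ 2 - z ^ 2 / 2 * ((N : ℂ) * ((N : ℂ) + 1) * (2 * (N : ℂ) + 1) / 6) + z ^ 3 / 3 * ((N : ℂ) * ((N : ℂ) + 1) / 2) - z ^ 4 / 4 * (N : ℂ) + z ^ 5 / 5 * (harmonic N : ℂ)) := by
  have h0 := powQuotientSum_self 1 N
  have h1 := powQuotientSum_succ_right 1 N
  have h2 := powQuotientSum_add_one 1 N
  have h3 := powQuotientSum_self 2 N
  have h4 := powQuotientSum_succ_right 2 N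
  have h5 := powQuotientSum_add_two 1 N
  have h6 := powQuotientSum_add_one 2 N
  have h7 := powQuotientSum_self 3 N
  have h8 := powQuotientSum_succ_right 3 N
  have h9 := powQuotientSum_add_three 1 N
  have h10 := powQuotientSum_add_two 2 N
  have h11 := powQuotientSum_add_one 3 N
  have h12 := powQuotientSum_self 4 N
  have h13 := powQuotientSum_succ_right 4 N
  norm_num at h0 h1 h2 h3 h4 h5 h6 h7 h8 h9 h10 h11 h12 h13
  rw [sum_taylorPart]
  norm_num [weightFive, Finset.sum_range_succ, h0, h1, h2, h3, h4, h5, h6, h7, h8, h9, h10, h11, h12, h13]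
  ring

lemma taylorPart_five (z : ℂ) {N : ℕ} (hN : (N : ℂ) ≠ 0) :
    weightFive.taylorPart z N =
      1 / 4 * (z ^ 1 / 1 * (N : ℂ) ^ 0 - z ^ 2 / 2 * (N : ℂ)⁻¹)
      + 11 / 24 * (z ^ 1 / 1 * (N : ℂ) ^ 1 - z ^ 2 / 2 * (N : ℂ) ^ 0 + z ^ 3 / 3 * (N : ℂ)⁻¹)
      + 1 / 4 * (z ^ 1 / 1 * (N : ℂ) ^ 2 - z ^ 2 / 2 * (N : ℂ) ^ 1 + z ^ 3 / 3 * (N : ℂ) ^ 0 - z ^ 4 / 4 * (N : ℂ)⁻¹)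
      + 1 / 24 * (z ^ 1 / 1 * (N : ℂ) ^ 3 - z ^ 2 / 2 * (N : ℂ) ^ 2 + z ^ 3 / 3 * (N : ℂ) ^ 1 - z ^ 4 / 4 * (N : ℂ) ^ 0 + z ^ 5 / 5 * (N : ℂ)⁻¹) := by
  simp only [taylorPart, Complex.logTaylor]
  norm_num [weightFive, Finset.sum_range_succ]
  field_simp
  ring


/-- Here `G_0 (z + 1) = 1 + z` plays the part of a product whose only nontrivial factor is at `k =
1`. That factor contributes no logarithm, leaving `(z + 1) / N - (H_N - log N)`. -/
lemma tendsto_stepLog_one (z : ℂ) :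
    Tendsto (weightOne.stepLog (fun k => if k = 1 then 1 else 0) (fun _ => 0) z) atTop
      (𝓝 (-(Real.eulerMascheroniConstant : ℂ))) := by
  have hinv : Tendsto (fun N : ℕ => (N : ℂ)⁻¹) atTop (𝓝 0) := tendsto_inv_atTop_nhds_zero_nat
  have h := ((hinv.const_mul (z + 1)).sub tendsto_harmonic_sub_log_sub).sub_const
    (Real.eulerMascheroniConstant : ℂ)
  refine (h.congr' ?_).trans (by simp)
  filter_upwards [eventually_ge_atTop 1] with N hN
  have hlog : ∑ i ∈ Finset.range N, (((if i + 1 = 1 then 1 else 0 : ℕ)) : ℂ)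
      * (Real.log ((i : ℝ) + 1) : ℂ) = 0 := by
    refine Finset.sum_eq_zero fun i _ => ?_
    by_cases hi : i = 0 <;> simp [hi]
  have hT : weightOne.taylorPart (z + 1) N = (z + 1) * (N : ℂ)⁻¹ := by
    simp [taylorPart, weightOne, Complex.logTaylor, Finset.sum_range_succ, div_eq_mul_inv]
  have hm : weightOne.mult N = 1 := by simp [weightOne, show N ≠ 0 by omega]
  rw [stepLog, hlog, hT, hm, Finset.sum_add_distrib, Finset.sum_sub_distrib, sum_taylorPart_one,
    sum_taylorPart_one]
  simp
  ring

/-- At this and the higher levels, `stepLog` minus its limit is an explicit combination of null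
sequences: `1 / N`, weighted by its coefficient in `taylorPart (z + 1) N`; the errors of the
logarithmic sums, weighted by the coefficients of the lower multiplicity; and `H_N - log N - γ`,
weighted by the harmonic coefficient of the summed Taylor parts. All growing terms cancel
identically, and equality of the constants is the difference equation that determines the exponent
polynomial. -/
lemma tendsto_stepLog_two (z : ℂ) :
    Tendsto (weightTwo.stepLog weightOne.mult (weightOne.taylorPart z) z) atTop
      (𝓝 ((-1) ^ weightTwo.degree * (Polynomial.aeval z exponentOne
        + Polynomial.aeval z exponentTwo - Polynomial.aeval (z + 1) exponentTwo))) := by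
  have hinv : Tendsto (fun N : ℕ => (N : ℂ)⁻¹) atTop (𝓝 0) := tendsto_inv_atTop_nhds_zero_nat
  have h := (((hinv.const_mul (1 * ((-1) * (z + 1) ^ 2 / 2) : ℂ)).sub
    (tendsto_powLogSum_zero.const_mul (1 : ℂ))).sub
    (tendsto_harmonic_sub_log_sub.const_mul (1 * ((-1) * ((z + 1) ^ 2 - z ^ 2) / 2) + 1 * ((1) * z ^ 1 / 1) : ℂ))).add_const
    ((-1) ^ weightTwo.degree * (Polynomial.aeval z exponentOne
        + Polynomial.aeval z exponentTwo - Polynomial.aeval (z + 1) exponentTwo))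
  refine (h.congr' ?_).trans (by simp)
  filter_upwards [eventually_ge_atTop 1] with N hN
  have hN0 : (N : ℂ) ≠ 0 := by exact_mod_cast (by omega : N ≠ 0)
  have hm := weightTwo.cast_mult hN
  have hV := weightOne.sum_mult_mul_log N
  norm_num [weightTwo, Finset.sum_range_succ] at hm
  rw [stepLog, hV, Finset.sum_add_distrib, Finset.sum_sub_distrib, sum_taylorPart_two,
    sum_taylorPart_two, sum_taylorPart_one, taylorPart_two _ hN0]
  simp only [aeval_exponentOne, aeval_exponentTwo]
  norm_num [weightOne, weightTwo, Finset.sum_range_succ, hm]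
  ring

lemma tendsto_stepLog_three (z : ℂ) :
    Tendsto (weightThree.stepLog weightTwo.mult (weightTwo.taylorPart z) z) atTop
      (𝓝 ((-1) ^ weightThree.degree * (Polynomial.aeval z exponentTwo
        + Polynomial.aeval z exponentThree - Polynomial.aeval (z + 1) exponentThree))) := by
  have hinv : Tendsto (fun N : ℕ => (N : ℂ)⁻¹) atTop (𝓝 0) := tendsto_inv_atTop_nhds_zero_nat
  have h := (((hinv.const_mul (1 / 2 * ((-1) * (z + 1) ^ 2 / 2) + 1 / 2 * ((1) * (z + 1) ^ 3 / 3) : ℂ)).sub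
    (tendsto_powLogSum_one.const_mul (1 : ℂ))).sub
    (tendsto_harmonic_sub_log_sub.const_mul (1 / 2 * ((-1) * ((z + 1) ^ 2 - z ^ 2) / 2) + 1 / 2 * ((1) * ((z + 1) ^ 3 - z ^ 3) / 3) + 1 * ((-1) * z ^ 2 / 2) : ℂ))).add_const
    ((-1) ^ weightThree.degree * (Polynomial.aeval z exponentTwo
        + Polynomial.aeval z exponentThree - Polynomial.aeval (z + 1) exponentThree))
  refine (h.congr' ?_).trans (by simp)
  filter_upwards [eventually_ge_atTop 1] with N hN
  have hN0 : (N : ℂ) ≠ 0 := by exact_mod_cast (by omega : N ≠ 0)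
  have hm := weightThree.cast_mult hN
  have hV := weightTwo.sum_mult_mul_log N
  norm_num [weightThree, Finset.sum_range_succ] at hm
  rw [stepLog, hV, Finset.sum_add_distrib, Finset.sum_sub_distrib, sum_taylorPart_three,
    sum_taylorPart_three, sum_taylorPart_two, taylorPart_three _ hN0]
  simp only [aeval_exponentTwo, aeval_exponentThree]
  norm_num [weightTwo, weightThree, Finset.sum_range_succ, hm]
  ring

lemma tendsto_stepLog_four (z : ℂ) :
    Tendsto (weightFour.stepLog weightThree.mult (weightThree.taylorPart z) z) atTop
      (𝓝 ((-1) ^ weightFour.degree * (Polynomial.aeval z exponentThree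
        + Polynomial.aeval z exponentFour - Polynomial.aeval (z + 1) exponentFour))) := by
  have hinv : Tendsto (fun N : ℕ => (N : ℂ)⁻¹) atTop (𝓝 0) := tendsto_inv_atTop_nhds_zero_nat
  have h := ((((hinv.const_mul (1 / 3 * ((-1) * (z + 1) ^ 2 / 2) + 1 / 2 * ((1) * (z + 1) ^ 3 / 3) + 1 / 6 * ((-1) * (z + 1) ^ 4 / 4) : ℂ)).sub
    (tendsto_powLogSum_one.const_mul (1 / 2 : ℂ))).sub
    (tendsto_powLogSum_two.const_mul (1 / 2 : ℂ))).sub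
    (tendsto_harmonic_sub_log_sub.const_mul (1 / 3 * ((-1) * ((z + 1) ^ 2 - z ^ 2) / 2) + 1 / 2 * ((1) * ((z + 1) ^ 3 - z ^ 3) / 3) + 1 / 6 * ((-1) * ((z + 1) ^ 4 - z ^ 4) / 4) + 1 / 2 * ((-1) * z ^ 2 / 2) + 1 / 2 * ((1) * z ^ 3 / 3) : ℂ))).add_const
    ((-1) ^ weightFour.degree * (Polynomial.aeval z exponentThree
        + Polynomial.aeval z exponentFour - Polynomial.aeval (z + 1) exponentFour))
  refine (h.congr' ?_).trans (by simp)
  filter_upwards [eventually_ge_atTop 1] with N hN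
  have hN0 : (N : ℂ) ≠ 0 := by exact_mod_cast (by omega : N ≠ 0)
  have hm := weightFour.cast_mult hN
  have hV := weightThree.sum_mult_mul_log N
  norm_num [weightFour, Finset.sum_range_succ] at hm
  rw [stepLog, hV, Finset.sum_add_distrib, Finset.sum_sub_distrib, sum_taylorPart_four,
    sum_taylorPart_four, sum_taylorPart_three, taylorPart_four _ hN0]
  simp only [aeval_exponentThree, aeval_exponentFour]
  norm_num [weightThree, weightFour, Finset.sum_range_succ, hm]
  ring

lemma tendsto_stepLog_five (z : ℂ) :
    Tendsto (weightFive.stepLog weightFour.mult (weightFour.taylorPart z) z) atTop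
      (𝓝 ((-1) ^ weightFive.degree * (Polynomial.aeval z exponentFour
        + Polynomial.aeval z exponentFive - Polynomial.aeval (z + 1) exponentFive))) := by
  have hinv : Tendsto (fun N : ℕ => (N : ℂ)⁻¹) atTop (𝓝 0) := tendsto_inv_atTop_nhds_zero_nat
  have h := (((((hinv.const_mul (1 / 4 * ((-1) * (z + 1) ^ 2 / 2) + 11 / 24 * ((1) * (z + 1) ^ 3 / 3) + 1 / 4 * ((-1) * (z + 1) ^ 4 / 4) + 1 / 24 * ((1) * (z + 1) ^ 5 / 5) : ℂ)).sub
    (tendsto_powLogSum_one.const_mul (1 / 3 : ℂ))).sub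
    (tendsto_powLogSum_two.const_mul (1 / 2 : ℂ))).sub
    (tendsto_powLogSum_three.const_mul (1 / 6 : ℂ))).sub
    (tendsto_harmonic_sub_log_sub.const_mul (1 / 4 * ((-1) * ((z + 1) ^ 2 - z ^ 2) / 2) + 11 / 24 * ((1) * ((z + 1) ^ 3 - z ^ 3) / 3) + 1 / 4 * ((-1) * ((z + 1) ^ 4 - z ^ 4) / 4) + 1 / 24 * ((1) * ((z + 1) ^ 5 - z ^ 5) / 5) + 1 / 3 * ((-1) * z ^ 2 / 2) + 1 / 2 * ((1) * z ^ 3 / 3) + 1 / 6 * ((-1) * z ^ 4 / 4) : ℂ))).add_const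
    ((-1) ^ weightFive.degree * (Polynomial.aeval z exponentFour
        + Polynomial.aeval z exponentFive - Polynomial.aeval (z + 1) exponentFive))
  refine (h.congr' ?_).trans (by simp)
  filter_upwards [eventually_ge_atTop 1] with N hN
  have hN0 : (N : ℂ) ≠ 0 := by exact_mod_cast (by omega : N ≠ 0)
  have hm := weightFive.cast_mult hN
  have hV := weightFour.sum_mult_mul_log N
  norm_num [weightFive, Finset.sum_range_succ] at hm
  rw [stepLog, hV, Finset.sum_add_distrib, Finset.sum_sub_distrib, sum_taylorPart_five,
    sum_taylorPart_five, sum_taylorPart_four, taylorPart_five _ hN0]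
  simp only [aeval_exponentFour, aeval_exponentFive]
  norm_num [weightFour, weightFive, Finset.sum_range_succ, hm]
  ring


/-! ### Identification of `G_1, …, G_5` -/

/-- The inductive step in the identification of the multiple gamma functions. -/
lemma multipleGamma_succ_eq_of_eq {n : ℕ} {V W : ProductWeight} {Q P : Polynomial ℝ}
    (hV : V.degree = n) (hQ : Q.natDegree ≤ V.degree)
    (hQV : multipleGamma n = fun z => V.weierstrassGamma Q (z - 1))
    (hW : W.degree = n + 1) (hP : P.natDegree ≤ W.degree) (hP0 : P.coeff 0 = 0)
    (h0 : W.mult 0 = 0) (hb : ∀ k, W.mult (k + 1) = W.mult k + V.mult (k + 1))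
    (hc : ∀ z, Tendsto (W.stepLog V.mult (V.taylorPart z) z) atTop (𝓝 ((-1) ^ W.degree *
      (Polynomial.aeval z Q + Polynomial.aeval z P - Polynomial.aeval (z + 1) P)))) :
    multipleGamma (n + 1) = fun z => W.weierstrassGamma P (z - 1) := by
  refine W.multipleGamma_succ_eq P hW hP hP0 (fun z hz => ?_) ?_
  · rw [hQV]
    simpa using W.weierstrassGamma_add_one V P Q (by omega) h0 hb hz (hc z)
  · rw [hQV]
    simp only [add_sub_cancel_right]
    rw [← hV]
    exact V.tendsto_iteratedDeriv_log_weierstrassGamma Q hQ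

/-- The base level is separate because `1 + z` is not a canonical product with polynomial
multiplicities: its single zero is at `-1`. -/
lemma multipleGamma_one_eq :
    multipleGamma 1 = fun z => weightOne.weierstrassGamma exponentOne (z - 1) := by
  refine weightOne.multipleGamma_succ_eq exponentOne rfl natDegree_exponentOne_le
    coeff_exponentOne_zero (fun z hz => ?_) ?_
  · have hz1 : 1 + z ≠ 0 := by
      intro h
      refine hz 1 le_rfl ?_
      push_cast
      linear_combination h
    have hG : HasProd (fun i : ℕ => (1 + z / (i + 1 : ℕ)) ^ (if i + 1 = 1 then 1 else 0)
        * Complex.exp (-(0 : ℂ))) (1 + z) := by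
      have := hasProd_single (f := fun i : ℕ => (1 + z / (i + 1 : ℕ)) ^
        (if i + 1 = 1 then 1 else 0) * Complex.exp (-(0 : ℂ))) 0 (fun i hi => by simp [hi])
      simpa using this
    have key := weightOne.canonicalProduct_add_one_mul (b := fun k => if k = 1 then 1 else 0)
      (q := fun _ => 0) (by simp [weightOne])
      (fun k => by by_cases hk : k = 0 <;> simp [weightOne, hk]) hz hG (tendsto_stepLog_one z)
    have key' : weightOne.canonicalProduct (z + 1) = weightOne.canonicalProduct z * (1 + z)⁻¹ *
        Complex.exp (-(Real.eulerMascheroniConstant : ℂ)) := by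
      field_simp
      exact key
    simp only [weierstrassGamma, aeval_exponentOne, key', multipleGamma]
    have hd : weightOne.degree = 1 := rfl
    rw [hd, pow_one, zpow_neg_one, zpow_neg_one, mul_inv, mul_inv, inv_inv, ← Complex.exp_neg,
      neg_neg]
    have hexp : Complex.exp (-(Real.eulerMascheroniConstant : ℂ) * (z + 1))
        * Complex.exp (Real.eulerMascheroniConstant : ℂ)
        = Complex.exp (-(Real.eulerMascheroniConstant : ℂ) * z) := by
      rw [← Complex.exp_add]
      congr 1
      ring
    linear_combination (1 + z) * (weightOne.canonicalProduct z)⁻¹ * hexp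
  -- Decay at level `0`: the first derivative of `log (t + 1)` is `1 / (t + 1)`.
  · have h1 : Tendsto (fun t : ℝ => (t + 1)⁻¹) atTop (𝓝 0) :=
      tendsto_inv_atTop_zero.comp (tendsto_atTop_add_const_right _ _ tendsto_id)
    refine h1.congr' ?_
    filter_upwards [eventually_ge_atTop 0] with t ht
    have h2 : HasDerivAt (fun t : ℝ => Real.log (t + 1)) ((t + 1)⁻¹) t := by
      simpa using ((hasDerivAt_id t).add_const (1 : ℝ)).log (by simp; linarith)
    simpa [multipleGamma] using h2.deriv.symm

lemma multipleGamma_two_eq :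
    multipleGamma 2 = fun z => weightTwo.weierstrassGamma exponentTwo (z - 1) :=
  multipleGamma_succ_eq_of_eq (V := weightOne) (W := weightTwo) rfl natDegree_exponentOne_le
    multipleGamma_one_eq rfl natDegree_exponentTwo_le coeff_exponentTwo_zero
    (by simp [weightTwo])
    (fun k => by simp [weightOne, weightTwo])
    tendsto_stepLog_two

lemma multipleGamma_three_eq :
    multipleGamma 3 = fun z => weightThree.weierstrassGamma exponentThree (z - 1) :=
  multipleGamma_succ_eq_of_eq (V := weightTwo) (W := weightThree) rfl natDegree_exponentTwo_le
    multipleGamma_two_eq rfl natDegree_exponentThree_le coeff_exponentThree_zero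
    (by simp [weightThree])
    (fun k => by
      simp only [weightTwo, weightThree]
      rw [Nat.choose_succ_succ', Nat.choose_one_right, add_comm])
    tendsto_stepLog_three

lemma multipleGamma_four_eq :
    multipleGamma 4 = fun z => weightFour.weierstrassGamma exponentFour (z - 1) :=
  multipleGamma_succ_eq_of_eq (V := weightThree) (W := weightFour) rfl natDegree_exponentThree_le
    multipleGamma_three_eq rfl natDegree_exponentFour_le coeff_exponentFour_zero
    (by simp [weightFour])
    (fun k => by
      simp only [weightThree, weightFour]
      rw [show k + 1 + 2 = (k + 2) + 1 by ring, Nat.choose_succ_succ', add_comm])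
    tendsto_stepLog_four

lemma multipleGamma_five_eq :
    multipleGamma 5 = fun z => weightFive.weierstrassGamma exponentFive (z - 1) :=
  multipleGamma_succ_eq_of_eq (V := weightFour) (W := weightFive) rfl natDegree_exponentFour_le
    multipleGamma_four_eq rfl natDegree_exponentFive_le coeff_exponentFive_zero
    (by simp [weightFive])
    (fun k => by
      simp only [weightFour, weightFive]
      rw [show k + 1 + 3 = (k + 3) + 1 by ring, Nat.choose_succ_succ', add_comm])
    tendsto_stepLog_five

/-! ### The explicit factors -/

lemma weierstrassFactorThree_eq (z : ℂ) (k : ℕ+) :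
    weierstrassFactorThree z k = (weightThree.factor z k)⁻¹ := by
  have hk : ((k : ℕ) : ℂ) ≠ 0 := by exact_mod_cast k.ne_zero
  have hm : ((k : ℤ) * ((k : ℤ) + 1) / 2) = (weightThree.mult k : ℤ) := by
    refine Int.ediv_eq_of_eq_mul_right (by norm_num) ?_
    exact (two_mul_choose k).symm
  rw [weierstrassFactorThree, hm, factor, mul_inv, zpow_neg, zpow_natCast, ← Complex.exp_neg, neg_neg, taylorPart_three _ hk]
  congr 2
  field_simp
  ring

/-- At odd levels the product is the inverse of a canonical product. Inversion preserves convergence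
only where the limit is nonzero, hence the excluded points; level four needs no exclusion. -/
lemma hasProd_weierstrassFactorThree (z : ℂ) (hz : ∀ m : ℕ+, z ≠ -(m : ℂ)) :
    HasProd (weierstrassFactorThree z) (weightThree.canonicalProduct z)⁻¹ := by
  have h := hasProd_pnat_iff_hasProd_succ.2 (weightThree.hasProd_factor z)
  have hne := weightThree.canonicalProduct_ne_zero fun k hk => hz ⟨k, hk⟩
  exact (h.inv₀ hne).congr_fun fun k => weierstrassFactorThree_eq z k

lemma weierstrassFactorFour_eq (z : ℂ) (k : ℕ+) :
    weierstrassFactorFour z k = (weightFour.factor z k) := by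
  have hk : ((k : ℕ) : ℂ) ≠ 0 := by exact_mod_cast k.ne_zero
  have hm : ((k : ℤ) * ((k : ℤ) + 1) * ((k : ℤ) + 2) / 6) = (weightFour.mult k : ℤ) := by
    refine Int.ediv_eq_of_eq_mul_right (by norm_num) ?_
    exact (six_mul_choose k).symm
  rw [weierstrassFactorFour, hm, factor, zpow_natCast, taylorPart_four _ hk]
  congr 2
  field_simp
  ring

lemma hasProd_weierstrassFactorFour (z : ℂ) :
    HasProd (weierstrassFactorFour z) (weightFour.canonicalProduct z) := by
  have h := hasProd_pnat_iff_hasProd_succ.2 (weightFour.hasProd_factor z)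
  exact h.congr_fun fun k => weierstrassFactorFour_eq z k

lemma weierstrassFactorFive_eq (z : ℂ) (k : ℕ+) :
    weierstrassFactorFive z k = (weightFive.factor z k)⁻¹ := by
  have hk : ((k : ℕ) : ℂ) ≠ 0 := by exact_mod_cast k.ne_zero
  have hm : ((k : ℤ) * ((k : ℤ) + 1) * ((k : ℤ) + 2) * ((k : ℤ) + 3) / 24) = (weightFive.mult k : ℤ) := by
    refine Int.ediv_eq_of_eq_mul_right (by norm_num) ?_
    exact (twentyfour_mul_choose k).symm
  rw [weierstrassFactorFive, hm, factor, mul_inv, zpow_neg, zpow_natCast, ← Complex.exp_neg, neg_neg, taylorPart_five _ hk]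
  congr 2
  field_simp
  ring

lemma hasProd_weierstrassFactorFive (z : ℂ) (hz : ∀ m : ℕ+, z ≠ -(m : ℂ)) :
    HasProd (weierstrassFactorFive z) (weightFive.canonicalProduct z)⁻¹ := by
  have h := hasProd_pnat_iff_hasProd_succ.2 (weightFive.hasProd_factor z)
  have hne := weightFive.canonicalProduct_ne_zero fun k hk => hz ⟨k, hk⟩
  exact (h.inv₀ hne).congr_fun fun k => weierstrassFactorFive_eq z k

end ProductWeight

lemma zetaDeriv_eq {j : ℕ} (hj : j < 4) : (zetaDeriv j : ℂ) = deriv riemannZeta (-j) :=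
  ofReal_re_deriv_riemannZeta_neg hj

end MultipleGamma

theorem proposition5p12 :
    (∀ z : ℂ, (∀ m : ℕ+, z ≠ -(m : ℂ)) →
      Multipliable (weierstrassFactorThree z) ∧
      multipleGamma 3 (z + 1) =
        Complex.exp (-(z ^ 3 / 4) + z ^ 2 / 8 + 7 / 24 * z
          + z * deriv riemannZeta (-1)
          - z * (z - 1) / 2 * deriv riemannZeta 0
          - (z ^ 3 / 6 - z ^ 2 / 4) * (Real.eulerMascheroniConstant : ℂ)) *
        ∏' k : ℕ+, weierstrassFactorThree z k) ∧
    (∀ z : ℂ,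
      Multipliable (weierstrassFactorFour z) ∧
      multipleGamma 4 (z + 1) =
        Complex.exp (-(11 / 144 * z ^ 4) + 2 / 9 * z ^ 3 - 5 / 144 * z ^ 2 - 5 / 24 * z
          - z / 2 * deriv riemannZeta (-2)
          + (z ^ 2 - 2 * z) / 2 * deriv riemannZeta (-1)
          - (z ^ 3 - 3 * z ^ 2 + 2 * z) / 6 * deriv riemannZeta 0
          - (z ^ 4 - 4 * z ^ 3 + 4 * z ^ 2) / 24 * (Real.eulerMascheroniConstant : ℂ)) *
        ∏' k : ℕ+, weierstrassFactorFour z k) ∧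
    (∀ z : ℂ, (∀ m : ℕ+, z ≠ -(m : ℂ)) →
      Multipliable (weierstrassFactorFive z) ∧
      multipleGamma 5 (z + 1) =
        Complex.exp (-(5 / 288 * z ^ 5) + 7 / 64 * z ^ 4 - 161 / 864 * z ^ 3 + 469 / 2880 * z
          + z / 6 * deriv riemannZeta (-3)
          - (z ^ 2 - 3 * z) / 4 * deriv riemannZeta (-2)
          + (2 * z ^ 3 - 9 * z ^ 2 + 11 * z) / 12 * deriv riemannZeta (-1)
          - (z ^ 4 - 6 * z ^ 3 + 11 * z ^ 2 - 6 * z) / 24 * deriv riemannZeta 0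
          - (6 * z ^ 5 - 45 * z ^ 4 + 110 * z ^ 3 - 90 * z ^ 2) / 720 *
              (Real.eulerMascheroniConstant : ℂ)) *
        ∏' k : ℕ+, weierstrassFactorFive z k) := by
  -- The exponent polynomials have real coefficients, so the complex derivatives are replaced by
  -- their real values.
  have z0 : deriv riemannZeta 0 = zetaDeriv 0 := by simpa using (zetaDeriv_eq (j := 0) (by norm_num)).symm
  have z1 : deriv riemannZeta (-1) = zetaDeriv 1 := by
    simpa using (zetaDeriv_eq (j := 1) (by norm_num)).symm
  have z2 : deriv riemannZeta (-2) = zetaDeriv 2 := by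
    simpa using (zetaDeriv_eq (j := 2) (by norm_num)).symm
  have z3 : deriv riemannZeta (-3) = zetaDeriv 3 := by
    simpa using (zetaDeriv_eq (j := 3) (by norm_num)).symm
  rw [z0, z1, z2, z3]
  refine ⟨fun z hz => ?_, fun z => ?_, fun z hz => ?_⟩
  · have h := ProductWeight.hasProd_weierstrassFactorThree z hz
    refine ⟨h.multipliable, ?_⟩
    rw [h.tprod_eq, ProductWeight.multipleGamma_three_eq]
    simp only [add_sub_cancel_right, ProductWeight.weierstrassGamma, aeval_exponentThree]
    rw [show (-1 : ℤ) ^ weightThree.degree = -1 by norm_num [weightThree], zpow_neg_one]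
    congr 2
    ring
  · have h := ProductWeight.hasProd_weierstrassFactorFour z
    refine ⟨h.multipliable, ?_⟩
    rw [h.tprod_eq, ProductWeight.multipleGamma_four_eq]
    simp only [add_sub_cancel_right, ProductWeight.weierstrassGamma, aeval_exponentFour]
    rw [show (-1 : ℤ) ^ weightFour.degree = 1 by norm_num [weightFour], zpow_one]
    congr 2
    ring
  · have h := ProductWeight.hasProd_weierstrassFactorFive z hz
    refine ⟨h.multipliable, ?_⟩
    rw [h.tprod_eq, ProductWeight.multipleGamma_five_eq]
    simp only [add_sub_cancel_right, ProductWeight.weierstrassGamma, aeval_exponentFive]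
    rw [show (-1 : ℤ) ^ weightFive.degree = -1 by norm_num [weightFive], zpow_neg_one]
    congr 2
    ring
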